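/- **Theorem (Poisson law and number of $F$-free (multi)graphs, strictly balanced $F$).** The density of a finite (multi)graph is its number of edges divided by its number of vertices ($0$ for the empty one). A nonempty (multi)graph $F$ is strictly balanced if its density is greater than the density of each of its strict subgraphs (the empty one included). $G[F]$ denotes the number of subgraphs of $G$ that are isomorphic to $F$. Let $c>0$ and let $m=m(n)$ be a sequence of nonnegative integers with $m(n)\to\infty$ as $n\to\infty$. (1) Simple graphs. Let $F$ be a strictly balanced simple graph of density $d$, with $\ell$ edges and $\mathrm{aut}(F)$ automorphisms, let $m\sim c\,n^{2-1/d}$, and put $\lambda=(2c)^{\ell}/\mathrm{aut}(F)$. Let $\mathrm{SG}_{n,m}$ be the number of simple graphs with $n$ labeled vertices and $m$ edges, and $\mathrm{SG}^F_{n,m,0}$ the number of those that contain no subgraph isomorphic to $F$. If $G$ is uniform among the simple graphs with $n$ labeled vertices and $m$ edges, then for every integer $t\ge 0$ $$\lim_{n\to\infty}\mathbb P(G[F]=t)=\frac{\lambda^t}{t!}e^{-\lambda},\qquad\text{and}\qquad \mathrm{SG}^F_{n,m,0}\sim e^{-\lambda}\,\mathrm{SG}_{n,m}.$$ (2) Multigraphs.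 Here a multigraph has labeled vertices and labeled, oriented edges, loops and multiple edges being allowed, so that there are $\mathrm{MG}_{n,m}=n^{2m}$ multigraphs on $n$ labeled vertices with $m$ labeled edges. An isomorphism is a pair of bijections, of the vertices and of the edges, that respects the oriented endpoints (labels are ignored). Let $F$ be a strictly balanced multigraph of density $d$ with $\ell$ edges, let $\mathrm{aut}(F)$ be the number of isomorphisms from $F$ to itself, let $m\sim c\,n^{2-1/d}$, and put $\lambda=c^{\ell}/\mathrm{aut}(F)$. If $G$ is uniform among the multigraphs on $n$ labeled vertices with $m$ labeled edges, then for every integer $t\ge 0$ $$\lim_{n\to\infty}\mathbb P(G[F]=t)=\frac{\lambda^t}{t!}e^{-\lambda},\qquad\text{and}\qquad \mathrm{MG}^F_{n,m,0}\sim e^{-\lambda}\,\mathrm{MG}_{n,m},$$ where $\mathrm{MG}^F_{n,m,0}$ is the number of those multigraphs that contain no subgraph isomorphic to $F$. -/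

import Mathlib

namespace SubgraphCount

noncomputable section

/-! ### Simple graphs -/

/-- The number of edges of a simple graph divided by its number of vertices
(`0` for the empty graph). -/
def density {V : Type*} (F : SimpleGraph V) : ℝ :=
  (Nat.card F.edgeSet : ℝ) / (Nat.card V : ℝ)

/-- The density of a subgraph (`0` for the empty subgraph, which is allowed). -/
def subDensity {V : Type*} {F : SimpleGraph V} (H : F.Subgraph) : ℝ :=
  (H.edgeSet.ncard : ℝ) / (H.verts.ncard : ℝ)

/-- A (nonempty) graph is strictly balanced if its density is greater than the density of each of
its strict subgraphs. The empty graph has no strict subgraph at all and is excluded. -/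
def StrictlyBalanced {V : Type*} (F : SimpleGraph V) : Prop :=
  Nonempty V ∧ ∀ H : F.Subgraph, H ≠ ⊤ → subDensity H < density F

/-- All simple graphs with `n` labeled vertices and `m` edges. -/
def simpleGraphs (n m : ℕ) : Set (SimpleGraph (Fin n)) :=
  {G | Nat.card G.edgeSet = m}

/-- All simple graphs with `n` labeled vertices and `m` edges that have exactly `t` subgraphs
isomorphic to `F`. -/
def simpleGraphsWithCopies {V : Type*} (F : SimpleGraph V) (n m t : ℕ) :
    Set (SimpleGraph (Fin n)) :=
  {G ∈ simpleGraphs n m | G.copyCount F = t}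

/-- The probability that a uniform random `(n, m)`-graph has exactly `t` subgraphs isomorphic
to `F`. -/
def simpleProb {V : Type*} (F : SimpleGraph V) (n m t : ℕ) : ℝ :=
  ((simpleGraphsWithCopies F n m t).ncard : ℝ) / ((simpleGraphs n m).ncard : ℝ)

/-! ### Multigraphs -/

/-- A multigraph with vertex labels `V` and edge labels `E`: every edge is oriented, and loops and
multiple edges are allowed. -/
structure Multigraph (V E : Type*) where
  src : E → V
  tgt : E → V

namespace Multigraph

/-- An isomorphism of multigraphs: a bijection of the vertices together with a bijection of the
edges that respects the (oriented) endpoints; labels are ignored. -/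
structure Iso {V E V' E' : Type*} (M : Multigraph V E) (N : Multigraph V' E') where
  onVerts : V ≃ V'
  onEdges : E ≃ E'
  src_map : ∀ e, N.src (onEdges e) = onVerts (M.src e)
  tgt_map : ∀ e, N.tgt (onEdges e) = onVerts (M.tgt e)

/-- A subgraph of a multigraph: a set of vertices and a set of edges between them. -/
@[ext] structure Subgraph {V E : Type*} (M : Multigraph V E) where
  verts : Set V
  edges : Set E
  src_mem : ∀ e ∈ edges, M.src e ∈ verts
  tgt_mem : ∀ e ∈ edges, M.tgt e ∈ verts

/-- A subgraph as a multigraph in its own right. -/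
def Subgraph.coe {V E : Type*} {M : Multigraph V E} (H : M.Subgraph) :
    Multigraph H.verts H.edges where
  src e := ⟨M.src e, H.src_mem e e.2⟩
  tgt e := ⟨M.tgt e, H.tgt_mem e e.2⟩

/-- The number of edges divided by the number of vertices (`0` for the empty multigraph). -/
def density {V E : Type*} (_M : Multigraph V E) : ℝ :=
  (Nat.card E : ℝ) / (Nat.card V : ℝ)

/-- A (nonempty) multigraph is strictly balanced if its density is greater than the density of each
of its strict subgraphs (the empty subgraph included). -/
def StrictlyBalanced {V E : Type*} (M : Multigraph V E) : Prop :=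
  Nonempty V ∧ ∀ H : M.Subgraph, ¬ (H.verts = Set.univ ∧ H.edges = Set.univ) →
    H.coe.density < M.density

/-- The number of subgraphs of `G` that are isomorphic to `F`. -/
def copyCount {V E W D : Type*} (G : Multigraph W D) (F : Multigraph V E) : ℕ :=
  {H : G.Subgraph | Nonempty (F.Iso H.coe)}.ncard

/-- All multigraphs with `n` labeled vertices and `m` labeled oriented edges that have exactly `t`
subgraphs isomorphic to `F`. -/
def withCopies {V E : Type*} (F : Multigraph V E) (n m t : ℕ) :
    Set (Multigraph (Fin n) (Fin m)) :=
  {G | G.copyCount F = t}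

/-- The probability that a uniform random `(n, m)`-multigraph has exactly `t` subgraphs isomorphic
to `F`. -/
def prob {V E : Type*} (F : Multigraph V E) (n m t : ℕ) : ℝ :=
  ((F.withCopies n m t).ncard : ℝ) / (Nat.card (Multigraph (Fin n) (Fin m)) : ℝ)

end Multigraph

end

end SubgraphCount

namespace SubgraphCount

open Filter Topology Finset

/-! ### The method of factorial moments for the Poisson law -/

/-! The proof is the method of factorial moments. Let X be the number of copies of F, with k
vertices, l edges and a automorphisms. If E[(X)_r] tends to λ^r for every r, then Bonferroni's
inequalities sandwich P(X = t) between truncations of the Poisson series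
(`tendsto_poisson_of_factorial_moments`).

The falling factorial (X)_r counts ordered r-tuples of distinct copies. Each copy is the image of
exactly a embeddings, so a^r (X)_r counts r-tuples of embeddings with distinct images. Strict
balance splits these in two (`disj_or_dense`): either the copies are pairwise disjoint, or their
union, with v vertices and e edges, is strictly denser than F, that is l v < k e.

Put p = m / C(n,2) for simple graphs and p = m / n^2 for multigraphs, so that p n^(k/l) tends to c',
which is 2c and c respectively. Disjoint tuples contribute asymptotically n^(rk) p^(rl), which tends
to (c'^l)^r. Tuples whose union has v vertices and e edges contribute O(n^v p^e), which tends to 0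
when l v < k e, and for fixed r only finitely many pairs (v, e) occur. Hence E[(X)_r] tends to (c'^l
/ a)^r.

Everything up to the two estimates on tuples is common to both settings and is done once, for a
`CopyModel`; each setting then supplies `sum_good` and `sum_bad_le`. The count of F-free structures
is the case t = 0. -/

lemma alternating_sum_choose_succ (y J : ℕ) :
    ∑ j ∈ range (J + 1), (-1 : ℝ) ^ j * ((y + 1).choose j : ℝ) = (-1) ^ J * (y.choose J : ℝ) := by
  induction J with
  | zero => simp
  | succ J ih =>
    rw [sum_range_succ, ih, Nat.choose_succ_succ]
    push_cast
    ring

/-- For positive y and J the truncated alternating sum telescopes to ± C(y-1, J-1), which Pascal's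
rule bounds by C(y, J). -/
lemma abs_indicator_sub_alternating_sum_le (y J : ℕ) :
    |(if y = 0 then (1 : ℝ) else 0) - ∑ j ∈ range J, (-1 : ℝ) ^ j * (y.choose j : ℝ)|
      ≤ (y.choose J : ℝ) := by
  rcases J with _ | J
  · split_ifs <;> simp
  rcases y with _ | y
  · rw [sum_range_succ']
    simp
  · rw [alternating_sum_choose_succ]
    simp only [Nat.add_eq_zero_iff, one_ne_zero, and_false, if_false, zero_sub, abs_neg, abs_mul,
      abs_pow, abs_one, one_pow, one_mul, Nat.abs_cast]
    exact_mod_cast (by rw [Nat.choose_succ_succ]; omega : y.choose J ≤ (y + 1).choose (J + 1))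

/-- Bonferroni's inequalities. -/
lemma bonferroni (x t J : ℕ) :
    |(if x = t then (1 : ℝ) else 0) -
        ∑ j ∈ range J, (-1 : ℝ) ^ j * ((t + j).choose t * x.choose (t + j) : ℝ)|
      ≤ ((t + J).choose t * x.choose (t + J) : ℝ) := by
  -- This identity reduces the claim to the indicator of x - t = 0, with the common factor C(x, t).
  have key : ∀ j, ((t + j).choose t * x.choose (t + j) : ℝ) = x.choose t * (x - t).choose j := by
    intro j
    have := Nat.choose_mul (n := x) (k := t + j) (s := t) (by omega)
    rw [Nat.add_sub_cancel_left] at this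
    rw [mul_comm]
    exact_mod_cast this
  simp only [key]
  rcases lt_or_ge x t with h | h
  · simp [Nat.choose_eq_zero_of_lt h, h.ne]
  · have h1 : (if x = t then (1 : ℝ) else 0) = x.choose t * (if x - t = 0 then (1 : ℝ) else 0) := by
      rcases h.eq_or_lt with rfl | h'
      · simp
      · rw [if_neg h'.ne', if_neg (by omega), mul_zero]
    have h2 : ∑ j ∈ range J, (-1 : ℝ) ^ j * (x.choose t * (x - t).choose j : ℝ)
        = x.choose t * ∑ j ∈ range J, (-1 : ℝ) ^ j * ((x - t).choose j : ℝ) := by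
      rw [mul_sum]
      exact sum_congr rfl fun j _ => by ring
    rw [h1, h2, ← mul_sub, abs_mul, Nat.abs_cast]
    exact mul_le_mul_of_nonneg_left (abs_indicator_sub_alternating_sum_le _ _) (Nat.cast_nonneg _)

/-- Bonferroni averaged over `S`, with the binomial products rewritten as falling factorials: C(t+j,
t) C(x, t+j) = (x)_(t+j) / (t! j!). -/
lemma abs_prob_sub_le {Ω : Type*} (S : Finset Ω) (X : Ω → ℕ) (t J : ℕ) :
    |(#{ω ∈ S | X ω = t} : ℝ) / #S -
        ∑ j ∈ range J, (-1 : ℝ) ^ j / (t.factorial * j.factorial) *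
          ((∑ ω ∈ S, ((X ω).descFactorial (t + j) : ℝ)) / #S)|
      ≤ 1 / (t.factorial * J.factorial) *
          ((∑ ω ∈ S, ((X ω).descFactorial (t + J) : ℝ)) / #S) := by
  have hc : ∀ (x j : ℕ), ((t + j).choose t * x.choose (t + j) : ℝ)
      = 1 / (t.factorial * j.factorial) * x.descFactorial (t + j) := by
    intro x j
    rw [Nat.descFactorial_eq_factorial_mul_choose,
      ← Nat.add_choose_mul_factorial_mul_factorial t j, ← Nat.choose_symm_add]
    have := Nat.factorial_ne_zero t
    have := Nat.factorial_ne_zero j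
    push_cast
    field_simp
  have e1 : (#{ω ∈ S | X ω = t} : ℝ) / #S -
        ∑ j ∈ range J, (-1 : ℝ) ^ j / (t.factorial * j.factorial) *
          ((∑ ω ∈ S, ((X ω).descFactorial (t + j) : ℝ)) / #S)
      = (∑ ω ∈ S, ((if X ω = t then (1 : ℝ) else 0) -
        ∑ j ∈ range J, (-1 : ℝ) ^ j * ((t + j).choose t * (X ω).choose (t + j) : ℝ))) / #S := by
    rw [sum_sub_distrib, sub_div, sum_comm]
    congr 1
    · simp
    · rw [sum_div]
      refine sum_congr rfl fun j _ => ?_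
      rw [← mul_sum]
      simp only [hc]
      rw [← mul_sum]
      ring
  rw [e1, abs_div, Nat.abs_cast, ← mul_div_assoc, mul_sum]
  refine div_le_div_of_nonneg_right ?_ (Nat.cast_nonneg _)
  refine (abs_sum_le_sum_abs _ _).trans (sum_le_sum fun ω _ => ?_)
  rw [← hc]
  exact bonferroni _ _ _

/-- If all factorial moments converge to those of the Poisson law, so do the probabilities. -/
theorem tendsto_poisson_of_factorial_moments {Ω : ℕ → Type*} (S : ∀ n, Finset (Ω n))
    (X : ∀ n, Ω n → ℕ) (lam : ℝ)
    (h : ∀ r, Tendsto (fun n => (∑ ω ∈ S n, ((X n ω).descFactorial r : ℝ)) / #(S n)) atTop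
      (𝓝 (lam ^ r))) (t : ℕ) :
    Tendsto (fun n => (#{ω ∈ S n | X n ω = t} : ℝ) / #(S n)) atTop
      (𝓝 (lam ^ t / t.factorial * Real.exp (-lam))) := by
  have hs : Tendsto (fun J => ∑ j ∈ range J, (-1 : ℝ) ^ j / (t.factorial * j.factorial) *
      lam ^ (t + j)) atTop (𝓝 (lam ^ t / t.factorial * Real.exp (-lam))) := by
    have := (NormedSpace.expSeries_div_hasSum_exp (-lam)).tendsto_sum_nat.const_mul
      (lam ^ t / t.factorial)
    rw [← Real.exp_eq_exp_ℝ] at this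
    refine this.congr fun J => ?_
    rw [mul_sum]
    refine sum_congr rfl fun j _ => ?_
    rw [neg_pow lam, pow_add]
    field_simp
  have hb : Tendsto (fun J => 1 / (t.factorial * J.factorial : ℝ) * lam ^ (t + J)) atTop (𝓝 0) := by
    have := (FloorSemiring.tendsto_pow_div_factorial_atTop lam).const_mul (lam ^ t / t.factorial)
    rw [mul_zero] at this
    refine this.congr fun J => ?_
    rw [pow_add]
    field_simp
  rw [Metric.tendsto_atTop]
  intro ε hε
  -- The truncation `J` is fixed first, making both the tail of the Poisson series and the limiting
  -- Bonferroni error less than ε/3; only then does `n` grow, so only finitely many moments are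
  -- involved.
  obtain ⟨J, hJ1, hJ2⟩ := ((Metric.tendsto_nhds.1 hs (ε / 3) (by positivity)).and
    (hb.eventually (gt_mem_nhds (show (0 : ℝ) < ε / 3 by positivity)))).exists
  have h1 : Tendsto (fun n => ∑ j ∈ range J, (-1 : ℝ) ^ j / (t.factorial * j.factorial) *
      ((∑ ω ∈ S n, ((X n ω).descFactorial (t + j) : ℝ)) / #(S n))) atTop
      (𝓝 (∑ j ∈ range J, (-1 : ℝ) ^ j / (t.factorial * j.factorial) * lam ^ (t + j))) :=
    tendsto_finsetSum _ fun j _ => (h (t + j)).const_mul _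
  have h2 := ((h (t + J)).const_mul (1 / (t.factorial * J.factorial : ℝ))).eventually
    (gt_mem_nhds hJ2)
  rw [← eventually_atTop]
  filter_upwards [Metric.tendsto_nhds.1 h1 (ε / 3) (by positivity), h2] with n hn1 hn2
  have hn3 := abs_prob_sub_le (S n) (X n) t J
  rw [Real.dist_eq] at *
  rw [abs_lt] at *
  rw [abs_le] at hn3
  constructor <;> linarith [hn1.1, hn1.2, hn3.1, hn3.2, hJ1.1, hJ1.2]

/-! ### Factorial moments of the number of copies of a strictly balanced structure -/

open scoped Classical in
-- Group the tuples by their images: there are (N)_r sequences of distinct images, and each entry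
-- lifts independently in `a` ways.
lemma card_tuples_injective_comp {Emb K : Type*} [Fintype Emb] (q : Emb → K) (Y : Finset Emb)
    (a r : ℕ) (hfib : ∀ e ∈ Y, #{e' ∈ Y | q e' = q e} = a) :
    #{T : Fin r → Emb | (∀ i, T i ∈ Y) ∧ Function.Injective fun i => q (T i)}
      = a ^ r * (#(Y.image q)).descFactorial r := by
  have hmaps : ∀ T ∈ ({T : Fin r → Emb | (∀ i, T i ∈ Y) ∧ Function.Injective fun i => q (T i)} :
      Finset (Fin r → Emb)), (fun i => q (T i)) ∈
      (Fintype.piFinset fun _ : Fin r => Y.image q).filter Function.Injective := by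
    intro T hT
    simp only [mem_filter, mem_univ, true_and, Fintype.mem_piFinset] at hT ⊢
    exact ⟨fun i => mem_image_of_mem _ (hT.1 i), hT.2⟩
  rw [card_eq_sum_card_fiberwise hmaps]
  have hcard : #((Fintype.piFinset fun _ : Fin r => Y.image q).filter Function.Injective)
      = (#(Y.image q)).descFactorial r := by
    have : Fintype.card (Fin r ↪ (Y.image q)) = (#(Y.image q)).descFactorial r := by
      rw [Fintype.card_embedding_eq, Fintype.card_fin, Fintype.card_coe]
    rw [← this, ← card_univ]
    symm
    refine card_bij (fun f _ i => (f i : K)) ?_ ?_ ?_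
    · intro f _
      simp only [mem_filter, Fintype.mem_piFinset]
      exact ⟨fun i => (f i).2, fun i j h => f.injective (Subtype.ext h)⟩
    · intro f _ g _ h
      ext i
      exact congrFun h i
    · intro s hs
      simp only [mem_filter, Fintype.mem_piFinset] at hs
      exact ⟨⟨fun i => ⟨s i, hs.1 i⟩, fun i j h => hs.2 (congrArg Subtype.val h)⟩, mem_univ _, rfl⟩
  rw [sum_const_nat (m := a ^ r), hcard, mul_comm]
  intro s hs
  simp only [mem_filter, Fintype.mem_piFinset, mem_image] at hs
  have : (({T : Fin r → Emb | (∀ i, T i ∈ Y) ∧ Function.Injective fun i => q (T i)} :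
      Finset (Fin r → Emb)).filter fun T => (fun i => q (T i)) = s)
      = Fintype.piFinset fun i => Y.filter fun e => q e = s i := by
    ext T
    simp only [mem_filter, mem_univ, true_and, Fintype.mem_piFinset]
    constructor
    · rintro ⟨⟨h1, -⟩, h3⟩ i
      exact ⟨h1 i, congrFun h3 i⟩
    · intro h
      have h3 : (fun i => q (T i)) = s := funext fun i => (h i).2
      exact ⟨⟨fun i => (h i).1, h3 ▸ hs.2⟩, h3⟩
  have hprod : ∀ i ∈ (univ : Finset (Fin r)), #{e ∈ Y | q e = s i} = a := by
    intro i _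
    obtain ⟨e, he, hei⟩ := hs.1 i
    rw [← hei]
    exact hfib e he
  rw [this, Fintype.card_piFinset, prod_congr rfl hprod, prod_const, card_univ, Fintype.card_fin]

/-- Potential labelled copies `e : Emb` of a strictly balanced structure with `k` vertices, `l`
edges and `a` automorphisms, inside the structures `ω : Ω` whose vertices and edges are taken from
`W` and `D`. A copy is identified with its vertices and its edges. -/
structure CopyModel (Ω Emb W D : Type*) [DecidableEq W] [DecidableEq D] where
  verts : Emb → Finset W
  edges : Emb → Finset D
  present : Ω → Finset Emb
  -- The dependence on the structure is needed for multigraphs, where the ambient structure assigns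
  -- endpoints to an edge label.
  IsSub : Ω → Finset W → Finset D → Prop
  k : ℕ
  l : ℕ
  a : ℕ
  k_pos : 0 < k
  l_pos : 0 < l
  a_pos : 0 < a
  card_verts : ∀ e, #(verts e) = k
  card_edges : ∀ e, #(edges e) = l
  card_fiber : ∀ ω, ∀ e ∈ present ω,
    #{e' ∈ present ω | (verts e', edges e') = (verts e, edges e)} = a
  isSub_present : ∀ ω, ∀ e ∈ present ω, IsSub ω (verts e) (edges e)
  isSub_empty : ∀ ω B, IsSub ω ∅ B ↔ B = ∅
  isSub_union : ∀ ω A B A' B', IsSub ω A B → IsSub ω A' B' → IsSub ω (A ∪ A') (B ∪ B')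
  isSub_inter : ∀ ω A B A' B', IsSub ω A B → IsSub ω A' B' → IsSub ω (A ∩ A') (B ∩ B')
  -- The density inequality with denominators cleared. The empty subgraph has to be excluded, since
  -- it would give 0 < 0.
  balanced : ∀ ω, ∀ e ∈ present ω, ∀ A B, IsSub ω A B → A ⊆ verts e → B ⊆ edges e →
    A.Nonempty → (A, B) ≠ (verts e, edges e) → k * #B < l * #A

namespace CopyModel

variable {Ω Emb W D : Type*} [DecidableEq W] [DecidableEq D] (M : CopyModel Ω Emb W D)

/-- The number of copies. -/
def count (ω : Ω) : ℕ := #((M.present ω).image fun e => (M.verts e, M.edges e))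

/-- The vertices of a family of copies. -/
def allVerts {r : ℕ} (T : Fin r → Emb) : Finset W := univ.biUnion fun i => M.verts (T i)

/-- The edges of a family of copies. -/
def allEdges {r : ℕ} (T : Fin r → Emb) : Finset D := univ.biUnion fun i => M.edges (T i)

/-- The copies are pairwise disjoint. -/
def Disj {r : ℕ} (T : Fin r → Emb) : Prop :=
  ∀ i j, i ≠ j → Disjoint (M.verts (T i)) (M.verts (T j)) ∧
    Disjoint (M.edges (T i)) (M.edges (T j))

/-- The family of copies is denser than a single copy. -/
def Dense {r : ℕ} (T : Fin r → Emb) : Prop := M.l * #(M.allVerts T) < M.k * #(M.allEdges T)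

variable {M}

lemma isSub_biUnion {ι : Type*} [DecidableEq ι] (ω : Ω) (T : ι → Emb)
    (hT : ∀ i, T i ∈ M.present ω) (S : Finset ι) :
    M.IsSub ω (S.biUnion fun i => M.verts (T i)) (S.biUnion fun i => M.edges (T i)) := by
  induction S using Finset.induction with
  | empty => simp [M.isSub_empty]
  | insert i S _ ih =>
    rw [biUnion_insert, biUnion_insert]
    exact M.isSub_union _ _ _ _ _ (M.isSub_present _ _ (hT i)) ih

lemma weakly_balanced {ω : Ω} {e : Emb} (he : e ∈ M.present ω) {A : Finset W} {B : Finset D}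
    (h : M.IsSub ω A B) (hA : A ⊆ M.verts e) (hB : B ⊆ M.edges e) : M.k * #B ≤ M.l * #A := by
  rcases A.eq_empty_or_nonempty with rfl | hne
  · rw [(M.isSub_empty ω B).1 h]
    simp
  · by_cases heq : (A, B) = (M.verts e, M.edges e)
    · rw [Prod.mk.injEq] at heq
      rw [heq.1, heq.2, M.card_verts, M.card_edges, mul_comm]
    · exact (M.balanced ω e he A B h hA hB hne heq).le

/-- Call k e - l v the excess. It is modular under union and intersection and vanishes on a single
copy, so adding a copy changes it by minus the excess of the intersection. That intersection is a
subgraph of a copy, whose excess is at most 0. -/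
lemma excess_le_insert {ω : Ω} {e : Emb} (he : e ∈ M.present ω) {A : Finset W} {B : Finset D}
    (h : M.IsSub ω A B) :
    (M.k * #B - M.l * #A : ℤ) ≤ M.k * #(M.edges e ∪ B) - M.l * #(M.verts e ∪ A) := by
  have h1 := weakly_balanced he (M.isSub_inter _ _ _ _ _ (M.isSub_present _ _ he) h)
    inter_subset_left inter_subset_left
  have h2 := card_union_add_card_inter (M.verts e) A
  have h3 := card_union_add_card_inter (M.edges e) B
  rw [M.card_verts] at h2
  rw [M.card_edges] at h3
  zify at h1 h2 h3
  have h2' : (#(M.verts e ∪ A) : ℤ) = M.k + #A - #(M.verts e ∩ A) := by linarith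
  have h3' : (#(M.edges e ∪ B) : ℤ) = M.l + #B - #(M.edges e ∩ B) := by linarith
  rw [h2', h3']
  linarith

/-- Distinct copies that are not pairwise disjoint form a denser structure. -/
lemma disj_or_dense {ω : Ω} {r : ℕ} {T : Fin r → Emb} (hT : ∀ i, T i ∈ M.present ω)
    (hinj : Function.Injective fun i => (M.verts (T i), M.edges (T i))) :
    M.Disj T ∨ M.Dense T := by
  rw [or_iff_not_imp_left]
  intro hnd
  unfold Disj at hnd
  push Not at hnd
  obtain ⟨i, j, hij, hnd⟩ := hnd
  have hsub := M.isSub_inter _ _ _ _ _ (M.isSub_present _ _ (hT i)) (M.isSub_present _ _ (hT j))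
  -- Two copies that share an edge share a vertex, because a subgraph without vertices has no edges.
  have hne : (M.verts (T i) ∩ M.verts (T j)).Nonempty := by
    by_contra hemp
    rw [not_nonempty_iff_eq_empty] at hemp
    rw [hemp, M.isSub_empty] at hsub
    exact hnd (disjoint_iff_inter_eq_empty.2 hemp) (disjoint_iff_inter_eq_empty.2 hsub)
  have hstrict := M.balanced ω _ (hT i) _ _ hsub inter_subset_left inter_subset_left hne (by
    intro heq
    rw [Prod.mk.injEq, inter_eq_left, inter_eq_left] at heq
    refine hij (hinj (Prod.ext ?_ ?_))
    · exact eq_of_subset_of_card_le heq.1 (by rw [M.card_verts, M.card_verts])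
    · exact eq_of_subset_of_card_le heq.2 (by rw [M.card_edges, M.card_edges]))
  -- Start from the two meeting copies, whose union has positive excess because their intersection
  -- is a proper nonempty subgraph, and add the others one at a time; the excess never decreases.
  have key : ∀ S : Finset (Fin r), (0 : ℤ) <
      M.k * #((S ∪ {i, j}).biUnion fun i => M.edges (T i)) -
        M.l * #((S ∪ {i, j}).biUnion fun i => M.verts (T i)) := by
    intro S
    induction S using Finset.induction with
    | empty =>
      rw [empty_union, biUnion_insert, biUnion_insert, singleton_biUnion, singleton_biUnion]
      have h2 := card_union_add_card_inter (M.verts (T i)) (M.verts (T j))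
      have h3 := card_union_add_card_inter (M.edges (T i)) (M.edges (T j))
      rw [M.card_verts, M.card_verts] at h2
      rw [M.card_edges, M.card_edges] at h3
      zify at hstrict h2 h3
      rw [eq_sub_of_add_eq h2, eq_sub_of_add_eq h3]
      linarith
    | insert x S _ ih =>
      rw [insert_union, biUnion_insert, biUnion_insert]
      exact ih.trans_le (excess_le_insert (hT x) (isSub_biUnion ω T hT _))
  have := key univ
  rw [union_eq_left.2 (subset_univ _)] at this
  unfold Dense allVerts allEdges
  zify
  linarith

lemma injective_of_disj {r : ℕ} {T : Fin r → Emb} (h : M.Disj T) :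
    Function.Injective fun i => (M.verts (T i), M.edges (T i)) := by
  intro i j hij
  by_contra hne
  have h1 := (h i j hne).1
  rw [show M.verts (T i) = M.verts (T j) from (Prod.ext_iff.1 hij).1, disjoint_self, bot_eq_empty, ← card_eq_zero, M.card_verts] at h1
  exact M.k_pos.ne' h1

variable (M)

open scoped Classical in
/-- The number of structures in `S` that contain all the copies of the family. -/
noncomputable def hits (S : Finset Ω) {r : ℕ} (T : Fin r → Emb) : ℕ := #{ω ∈ S | ∀ i, T i ∈ M.present ω}

variable {M} in
open scoped Classical in
lemma hits_eq_zero {S : Finset Ω} {r : ℕ} {T : Fin r → Emb}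
    (h : ∀ ω ∈ S, ¬ ∀ i, T i ∈ M.present ω) : M.hits S T = 0 := by
  rw [hits, card_eq_zero, filter_eq_empty_iff]
  exact fun ω hω => h ω hω

open scoped Classical in
-- Double counting of pairs (structure, tuple present in it).
lemma sum_hits [Fintype Emb] (S : Finset Ω) {r : ℕ} (P : (Fin r → Emb) → Prop) :
    ∑ T : Fin r → Emb with P T, M.hits S T
      = ∑ ω ∈ S, #{T : Fin r → Emb | (∀ i, T i ∈ M.present ω) ∧ P T} := by
  simp only [hits, card_filter, sum_filter]
  rw [sum_comm (s := S)]
  refine sum_congr rfl fun T _ => ?_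
  by_cases P T <;> simp [*]

open scoped Classical in
-- Pairwise disjoint copies are distinct, which gives the lower bound; distinct copies are disjoint
-- or dense, which gives the upper bound.
lemma sum_descFactorial_count [Fintype Emb] (S : Finset Ω) (r : ℕ) :
    ∑ T : Fin r → Emb with M.Disj T, M.hits S T
        ≤ M.a ^ r * ∑ ω ∈ S, (M.count ω).descFactorial r ∧
      M.a ^ r * ∑ ω ∈ S, (M.count ω).descFactorial r
        ≤ ∑ T : Fin r → Emb with M.Disj T, M.hits S T
          + ∑ T : Fin r → Emb with M.Dense T, M.hits S T := by
  simp only [sum_hits]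
  rw [mul_sum, ← sum_add_distrib]
  have h : ∀ ω, M.a ^ r * (M.count ω).descFactorial r = #{T : Fin r → Emb |
      (∀ i, T i ∈ M.present ω) ∧ Function.Injective fun i => (M.verts (T i), M.edges (T i))} := by
    intro ω
    have := card_tuples_injective_comp (fun e => (M.verts e, M.edges e)) (M.present ω) M.a r
      (by convert M.card_fiber ω)
    unfold count
    convert this.symm
  simp only [h]
  constructor
  · refine sum_le_sum fun ω _ => card_le_card fun T hT => ?_
    simp only [mem_filter, mem_univ, true_and] at hT ⊢
    exact ⟨hT.1, injective_of_disj hT.2⟩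
  · refine sum_le_sum fun ω _ => (card_le_card fun T hT => ?_).trans (card_union_le _ _)
    simp only [mem_union, mem_filter, mem_univ, true_and] at hT ⊢
    rcases disj_or_dense hT.1 hT.2 with h | h
    · exact Or.inl ⟨hT.1, h⟩
    · exact Or.inr ⟨hT.1, h⟩

end CopyModel

/-! ### Asymptotics -/

open scoped Classical in
-- Choose the image, in at most |W|^v ways, and then a map into it.
lemma card_functions_image_card_le {I W : Type*} [Fintype I] [Fintype W] (v : ℕ) :
    #{g : I → W | #(univ.image g) = v} ≤ Fintype.card W ^ v * v ^ Fintype.card I := by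
  have hsub : ({g : I → W | #(univ.image g) = v} : Finset (I → W)) ⊆
      (powersetCard v univ).biUnion fun S => Fintype.piFinset fun _ => S := by
    intro g hg
    simp only [mem_filter, mem_univ, true_and, mem_biUnion, mem_powersetCard, subset_univ,
      Fintype.mem_piFinset] at hg ⊢
    exact ⟨_, hg, fun i => mem_image_of_mem _ (mem_univ i)⟩
  refine (card_le_card hsub).trans (card_biUnion_le.trans ?_)
  rw [sum_const_nat (m := v ^ Fintype.card I), card_powersetCard, card_univ]
  · exact Nat.mul_le_mul_right _ (Nat.choose_le_pow _ _)
  · intro S hS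
    rw [Fintype.card_piFinset, prod_const, (mem_powersetCard.1 hS).2, card_univ]

/-- Here n^v p^e = (p n^(k/l))^e n^(v - ke/l): the first factor converges and the last exponent is
negative. -/
lemma tendsto_pow_mul_pow_zero {p : ℕ → ℝ} {k l : ℕ} (hl : 0 < l) {c' : ℝ}
    (hp : Tendsto (fun n : ℕ => p n * (n : ℝ) ^ ((k : ℝ) / l)) atTop (𝓝 c')) {v e : ℕ}
    (h : l * v < k * e) : Tendsto (fun n : ℕ => (n : ℝ) ^ v * p n ^ e) atTop (𝓝 0) := by
  have hl' : (0 : ℝ) < l := by exact_mod_cast hl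
  have hpos : (0 : ℝ) < k / l * e - v := by
    rw [sub_pos, div_mul_eq_mul_div, lt_div_iff₀ hl', mul_comm]
    exact_mod_cast h
  have h1 := (hp.pow e).mul ((tendsto_rpow_neg_atTop hpos).comp tendsto_natCast_atTop_atTop)
  rw [mul_zero] at h1
  refine h1.congr' ?_
  filter_upwards [eventually_gt_atTop 0] with n hn
  have hn' : (0 : ℝ) < n := by exact_mod_cast hn
  simp only [Function.comp]
  rw [mul_pow, ← Real.rpow_natCast ((n : ℝ) ^ ((k : ℝ) / l)), ← Real.rpow_mul hn'.le, mul_assoc,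
    ← Real.rpow_add hn', mul_comm, ← Real.rpow_natCast (n : ℝ) v]
  congr 2
  ring

lemma tendsto_pow_mul_pow {p : ℕ → ℝ} {k l : ℕ} (hl : 0 < l) {c' : ℝ}
    (hp : Tendsto (fun n : ℕ => p n * (n : ℝ) ^ ((k : ℝ) / l)) atTop (𝓝 c')) (r : ℕ) :
    Tendsto (fun n : ℕ => (n : ℝ) ^ (r * k) * p n ^ (r * l)) atTop (𝓝 ((c' ^ l) ^ r)) := by
  have hl' : (l : ℝ) ≠ 0 := by exact_mod_cast hl.ne'
  have h1 := (hp.pow l).pow r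
  refine h1.congr fun n => ?_
  rw [mul_pow, ← Real.rpow_natCast ((n : ℝ) ^ ((k : ℝ) / l)), ← Real.rpow_mul n.cast_nonneg,
    div_mul_cancel₀ _ hl', Real.rpow_natCast, mul_comm, mul_pow, ← pow_mul, ← pow_mul,
    mul_comm k, mul_comm l]

lemma tendsto_descFactorial_div_pow (j : ℕ) :
    Tendsto (fun N : ℕ => (N.descFactorial j : ℝ) / (N : ℝ) ^ j) atTop (𝓝 1) := by
  refine (Asymptotics.isEquivalent_iff_tendsto_one ?_).1 (isEquivalent_descFactorial j)
  filter_upwards [eventually_gt_atTop 0] with N hN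
  positivity

namespace CopyModel

open scoped Classical in
-- Sorts dense families by the size of their union; the range of sizes depends only on r, k and l,
-- not on the ambient structure.
lemma sum_dense_hits {Ω Emb W D : Type*} [DecidableEq W] [DecidableEq D] [Fintype Emb]
    (M : CopyModel Ω Emb W D) (S : Finset Ω) (r : ℕ) :
    ∑ T : Fin r → Emb with M.Dense T, M.hits S T =
      ∑ x ∈ range (r * M.k + 1) ×ˢ range (r * M.l + 1) with M.l * x.1 < M.k * x.2,
        ∑ T : Fin r → Emb with #(M.allVerts T) = x.1 ∧ #(M.allEdges T) = x.2, M.hits S T := by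
  have hmaps : ∀ T ∈ ({T : Fin r → Emb | M.Dense T} : Finset _),
      (#(M.allVerts T), #(M.allEdges T)) ∈
        ((range (r * M.k + 1) ×ˢ range (r * M.l + 1)).filter
          fun x => M.l * x.1 < M.k * x.2) := by
    intro T hT
    simp only [mem_filter, mem_univ, true_and, mem_product, mem_range, Nat.lt_succ_iff] at hT ⊢
    refine ⟨⟨?_, ?_⟩, hT⟩
    · exact card_biUnion_le.trans (by simp [M.card_verts])
    · exact card_biUnion_le.trans (by simp [M.card_edges])
  rw [← sum_fiberwise_of_maps_to hmaps]
  refine sum_congr rfl fun x hx => sum_congr ?_ fun _ _ => rfl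
  ext T
  simp only [mem_filter, mem_univ, true_and, Prod.ext_iff] at hx ⊢
  constructor
  · exact fun h => h.2
  · rintro ⟨h1, h2⟩
    exact ⟨by rw [Dense, h1, h2]; exact hx.2, h1, h2⟩

open scoped Classical in
/-- The Poisson limit law for the number of copies. -/
theorem tendsto_poisson {Ω Emb W D : ℕ → Type*} [∀ n, DecidableEq (W n)]
    [∀ n, DecidableEq (D n)] [∀ n, Fintype (Emb n)] (M : ∀ n, CopyModel (Ω n) (Emb n) (W n) (D n))
    (S : ∀ n, Finset (Ω n)) {k l a : ℕ} (hk : ∀ n, (M n).k = k) (hl : ∀ n, (M n).l = l)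
    (ha : ∀ n, (M n).a = a) (p : ℕ → ℝ) (c' : ℝ)
    (hp : Tendsto (fun n : ℕ => p n * (n : ℝ) ^ ((k : ℝ) / l)) atTop (𝓝 c'))
    (hgood : ∀ r, Tendsto (fun n => ((∑ T : Fin r → Emb n with (M n).Disj T,
      (M n).hits (S n) T : ℕ) : ℝ) / #(S n)) atTop (𝓝 ((c' ^ l) ^ r)))
    (hbad : ∀ r v e, ∃ C : ℝ, ∀ᶠ n in atTop,
      ((∑ T : Fin r → Emb n with #((M n).allVerts T) = v ∧ #((M n).allEdges T) = e,
        (M n).hits (S n) T : ℕ) : ℝ) / #(S n) ≤ C * ((n : ℝ) ^ v * p n ^ e))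
    (t : ℕ) :
    Tendsto (fun n => (#{ω ∈ S n | (M n).count ω = t} : ℝ) / #(S n)) atTop
      (𝓝 ((c' ^ l / a) ^ t / t.factorial * Real.exp (-(c' ^ l / a)))) := by
  have hl0 : 0 < l := hl 0 ▸ (M 0).l_pos
  have ha0 : (0 : ℝ) < a := by exact_mod_cast ha 0 ▸ (M 0).a_pos
  refine tendsto_poisson_of_factorial_moments S (fun n => (M n).count) _ (fun r => ?_) t
  have hdense : Tendsto (fun n => ((∑ T : Fin r → Emb n with (M n).Dense T,
      (M n).hits (S n) T : ℕ) : ℝ) / #(S n)) atTop (𝓝 0) := by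
    have h1 : ∀ n, ((∑ T : Fin r → Emb n with (M n).Dense T, (M n).hits (S n) T : ℕ) : ℝ) / #(S n)
        = ∑ x ∈ range (r * k + 1) ×ˢ range (r * l + 1) with l * x.1 < k * x.2,
          ((∑ T : Fin r → Emb n with #((M n).allVerts T) = x.1 ∧ #((M n).allEdges T) = x.2,
            (M n).hits (S n) T : ℕ) : ℝ) / #(S n) := by
      intro n
      rw [sum_dense_hits, hk, hl, Nat.cast_sum, sum_div]
    simp only [h1]
    -- The index set does not depend on `n`, so the finite sum tends to 0 term by term.
    rw [← sum_const_zero (s := {x ∈ range (r * k + 1) ×ˢ range (r * l + 1) | l * x.1 < k * x.2})]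
    refine tendsto_finsetSum _ fun x hx => ?_
    obtain ⟨C, hC⟩ := hbad r x.1 x.2
    have h2 := (tendsto_pow_mul_pow_zero hl0 hp (mem_filter.1 hx).2).const_mul C
    rw [mul_zero] at h2
    exact tendsto_of_tendsto_of_tendsto_of_le_of_le' tendsto_const_nhds h2
      (Eventually.of_forall fun n => by positivity) hC
  have h3 : Tendsto (fun n => (a : ℝ) ^ r *
      ((∑ ω ∈ S n, (((M n).count ω).descFactorial r : ℝ)) / #(S n))) atTop
      (𝓝 ((c' ^ l) ^ r)) := by
    have h4 := (hgood r).add hdense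
    rw [add_zero] at h4
    refine tendsto_of_tendsto_of_tendsto_of_le_of_le (hgood r) h4 (fun n => ?_) (fun n => ?_)
    · have := (sum_descFactorial_count (M n) (S n) r).1
      rw [ha] at this
      dsimp only
      rw [← mul_div_assoc]
      exact div_le_div_of_nonneg_right (by exact_mod_cast this) (Nat.cast_nonneg _)
    · have := (sum_descFactorial_count (M n) (S n) r).2
      rw [ha] at this
      dsimp only
      rw [← mul_div_assoc, ← add_div]
      exact div_le_div_of_nonneg_right (by exact_mod_cast this) (Nat.cast_nonneg _)
  have h5 := h3.div_const ((a : ℝ) ^ r)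
  rw [div_pow]
  refine h5.congr fun n => ?_
  rw [mul_div_cancel_left₀ _ (by positivity)]

end CopyModel

lemma tendsto_edge_density {m : ℕ → ℕ} {c : ℝ} (hc : 0 < c) {s : ℝ}
    (h : Asymptotics.IsEquivalent atTop (fun n : ℕ => (m n : ℝ))
      (fun n : ℕ => c * (n : ℝ) ^ (2 - s))) :
    Tendsto (fun n : ℕ => (m n : ℝ) / (n : ℝ) ^ 2 * (n : ℝ) ^ s) atTop (𝓝 c) := by
  rw [Asymptotics.isEquivalent_iff_tendsto_one] at h
  · have h1 := h.mul_const c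
    rw [one_mul] at h1
    refine h1.congr' ?_
    filter_upwards [eventually_gt_atTop 0] with n hn
    have hn' : (0 : ℝ) < n := by exact_mod_cast hn
    have := Real.rpow_pos_of_pos hn' s
    simp only [Pi.div_apply]
    rw [Real.rpow_sub hn', Real.rpow_two]
    field_simp
  · filter_upwards [eventually_gt_atTop 0] with n hn
    have hn' : (0 : ℝ) < n := by exact_mod_cast hn
    positivity

lemma isEquivalent_of_tendsto_div {f g : ℕ → ℝ} {x : ℝ} (hx : x ≠ 0)
    (h : Tendsto (fun n => f n / g n) atTop (𝓝 x)) :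
    Asymptotics.IsEquivalent atTop f (fun n => x * g n) := by
  -- Division by zero gives 0, which is excluded near a nonzero limit.
  have hg : ∀ᶠ n in atTop, g n ≠ 0 := by
    filter_upwards [h.eventually_ne hx] with n hn h0
    simp [h0] at hn
  rw [Asymptotics.isEquivalent_iff_tendsto_one]
  · have h1 := h.div_const x
    rw [div_self hx] at h1
    refine h1.congr fun n => ?_
    simp only [Pi.div_apply]
    rw [div_div, mul_comm]
  · filter_upwards [hg] with n hn
    exact mul_ne_zero hx hn

/-! ### Counting families of embeddings -/

open scoped Classical in
-- A pairwise disjoint family of r embeddings of `I` is a single embedding of `Fin r × I`.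
lemma card_disjoint_embeddings (I W : Type*) [Fintype I] [Fintype W] (r : ℕ) :
    #{T : Fin r → (I ↪ W) | ∀ i j, i ≠ j → Disjoint (univ.map (T i)) (univ.map (T j))}
      = (Fintype.card W).descFactorial (r * Fintype.card I) := by
  have : Fintype.card (Fin r × I ↪ W) = (Fintype.card W).descFactorial (r * Fintype.card I) := by
    rw [Fintype.card_embedding_eq, Fintype.card_prod, Fintype.card_fin]
  rw [← this, ← card_univ]
  symm
  refine card_bij (fun f _ i => ⟨fun x => f (i, x), fun x y h => by simpa using f.injective h⟩)
    ?_ ?_ ?_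
  · intro f _
    simp only [mem_filter, mem_univ, true_and, disjoint_left, Finset.mem_map]
    rintro i j hij _ ⟨x, rfl⟩ ⟨y, hy⟩
    exact hij (Prod.ext_iff.1 (f.injective hy)).1.symm
  · intro f _ g _ h
    ext ⟨i, x⟩
    exact DFunLike.congr_fun (congrFun h i) x
  · intro T hT
    simp only [mem_filter, mem_univ, true_and] at hT
    refine ⟨⟨fun x => T x.1 x.2, ?_⟩, mem_univ _, rfl⟩
    rintro ⟨i, x⟩ ⟨j, y⟩ h
    change T i x = T j y at h
    obtain rfl | hij := eq_or_ne i j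
    · rw [(T i).injective h]
    · exact absurd (mem_map_of_mem (T j) (mem_univ y))
        (disjoint_left.1 (hT i j hij) (h ▸ mem_map_of_mem (T i) (mem_univ x)))

open scoped Classical in
lemma card_embeddings_union_card_le (I W : Type*) [Fintype I] [Fintype W] (r v : ℕ) :
    #{T : Fin r → (I ↪ W) | #(univ.biUnion fun i => univ.map (T i)) = v}
      ≤ Fintype.card W ^ v * v ^ (r * Fintype.card I) := by
  have h := card_functions_image_card_le (I := Fin r × I) (W := W) v
  rw [Fintype.card_prod, Fintype.card_fin] at h
  refine le_trans (card_le_card_of_injOn (fun T x => T x.1 x.2) ?_ ?_) h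
  · intro T hT
    simp only [coe_filter, mem_univ, true_and, Set.mem_ofPred_eq] at hT ⊢
    rw [← hT]
    congr 1
    ext w
    simp
  · intro T _ T' _ h
    ext i x
    exact congrFun h (i, x)

/-! ### Copies in simple graphs -/

namespace Simple

variable {V : Type*} [Fintype V] (F : SimpleGraph V)

open scoped Classical in
/-- The image of the edges of `F` under an embedding of the vertices. -/
noncomputable def edgeImage {W : Type*} (φ : V ↪ W) : Finset (Sym2 W) := F.edgeFinset.map φ.sym2Map

variable {F}

lemma mem_edgeImage {W : Type*} {φ : V ↪ W} {e : Sym2 W} :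
    e ∈ edgeImage F φ ↔ ∃ e' ∈ F.edgeSet, e'.map φ = e := by
  classical
  simp [edgeImage, Function.Embedding.sym2Map]

lemma map_mem_edgeImage {W : Type*} {φ : V ↪ W} {u v : V} :
    s(φ u, φ v) ∈ edgeImage F φ ↔ F.Adj u v := by
  rw [mem_edgeImage]
  constructor
  · rintro ⟨e', he', h⟩
    rw [← Sym2.map_mk] at h
    rwa [← F.mem_edgeSet, ← Sym2.map.injective φ.injective h]
  · exact fun h => ⟨s(u, v), h, rfl⟩

open scoped Classical in
lemma card_edgeImage {W : Type*} (φ : V ↪ W) : #(edgeImage F φ) = Nat.card F.edgeSet := by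
  rw [edgeImage, card_map, Nat.card_eq_fintype_card, SimpleGraph.edgeFinset_card]

lemma edgeImage_subset_iff {W : Type*} {φ : V ↪ W} {G : SimpleGraph W} :
    (∀ e ∈ edgeImage F φ, e ∈ G.edgeSet) ↔ ∀ u v, F.Adj u v → G.Adj (φ u) (φ v) := by
  constructor
  · exact fun h u v huv => h _ (map_mem_edgeImage.2 huv)
  · rintro h e he
    obtain ⟨e', he', rfl⟩ := mem_edgeImage.1 he
    induction e' with
    | _ u v => exact h u v he'

/-- A set of edges between given vertices. -/
def EdgesWithin {W : Type*} (A : Finset W) (B : Finset (Sym2 W)) : Prop := ∀ e ∈ B, ∀ x ∈ e, x ∈ A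

lemma edgesWithin_edgeImage {W : Type*} (φ : V ↪ W) :
    EdgesWithin (univ.map φ) (edgeImage F φ) := by
  intro e he x hx
  obtain ⟨e', -, rfl⟩ := mem_edgeImage.1 he
  obtain ⟨v, -, rfl⟩ := Sym2.mem_map.1 hx
  exact mem_map_of_mem φ (mem_univ v)

instance : Finite (F ≃g F) :=
  Finite.of_injective (fun σ => (σ : V → V)) DFunLike.coe_injective

open scoped Classical in
-- The embeddings with the same image as φ are the composites φ ∘ σ, with σ an automorphism of `F`.
lemma card_embeddings_same_image {W : Type*} [Fintype W] (φ : V ↪ W) :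
    #{φ' : V ↪ W | univ.map φ' = univ.map φ ∧ edgeImage F φ' = edgeImage F φ}
      = Nat.card (F ≃g F) := by
  have := Fintype.ofFinite (F ≃g F)
  rw [Nat.card_eq_fintype_card, ← card_univ]
  symm
  refine card_bij (fun σ _ => σ.toEquiv.toEmbedding.trans φ) ?_ ?_ ?_
  · intro σ _
    simp only [mem_filter, mem_univ, true_and]
    constructor
    · rw [← Finset.map_map, map_univ_equiv]
    · ext e
      simp only [mem_edgeImage]
      constructor
      · rintro ⟨e', he', rfl⟩
        refine ⟨e'.map σ, ?_, by rw [Sym2.map_map]; rfl⟩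
        induction e' with
        | _ u v => exact σ.map_adj_iff.2 he'
      · rintro ⟨e', he', rfl⟩
        refine ⟨e'.map σ.symm, ?_, ?_⟩
        · induction e' with
          | _ u v => exact σ.symm.map_adj_iff.2 he'
        · rw [Sym2.map_map]
          congr 1
          ext u
          simp
  · intro σ _ τ _ h
    ext u
    exact φ.injective (DFunLike.congr_fun h u)
  · intro φ' hφ'
    simp only [mem_filter, mem_univ, true_and] at hφ'
    have hex : ∀ u, ∃ v, φ v = φ' u := by
      intro u
      have := mem_map_of_mem φ' (mem_univ u)
      rw [hφ'.1] at this
      simpa using this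
    choose σ hσ using hex
    have hinj : Function.Injective σ := fun u v h =>
      φ'.injective (by rw [← hσ u, ← hσ v, h])
    refine ⟨⟨Equiv.ofBijective σ (Finite.injective_iff_bijective.1 hinj), ?_⟩, mem_univ _, ?_⟩
    · intro u v
      rw [Equiv.ofBijective_apply, Equiv.ofBijective_apply, ← map_mem_edgeImage (φ := φ), hσ, hσ,
        ← hφ'.2, map_mem_edgeImage]
    · ext u
      exact hσ u

/-- The empty subgraph has density 0, so `F` has positive density and hence an edge. -/
lemma strictlyBalanced_card {F : SimpleGraph V} (hF : StrictlyBalanced F) :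
    0 < Nat.card V ∧ 0 < Nat.card F.edgeSet := by
  obtain ⟨hV, hF⟩ := hF
  refine ⟨Nat.card_pos, ?_⟩
  have hbot : (⊥ : F.Subgraph) ≠ ⊤ := by
    intro h
    have h1 := congrArg SimpleGraph.Subgraph.verts h
    simp only [SimpleGraph.Subgraph.verts_bot, SimpleGraph.Subgraph.verts_top] at h1
    exact Set.empty_ne_univ h1
  have h := hF ⊥ hbot
  by_contra h0
  simp [subDensity, density, Nat.eq_zero_of_not_pos h0] at h

/-- Pull (A, B) back along φ to a proper subgraph of `F` and clear denominators in the density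
inequality. -/
lemma mul_card_lt {W : Type*} {F : SimpleGraph V} (hF : StrictlyBalanced F) (φ : V ↪ W)
    {A : Finset W} {B : Finset (Sym2 W)} (hAB : EdgesWithin A B) (hA : A ⊆ univ.map φ)
    (hB : B ⊆ edgeImage F φ) (hne : A.Nonempty)
    (hneq : (A, B) ≠ (univ.map φ, edgeImage F φ)) :
    Nat.card V * #B < Nat.card F.edgeSet * #A := by
  classical
  let H : F.Subgraph :=
    { verts := {v | φ v ∈ A}
      Adj := fun u v => s(φ u, φ v) ∈ B
      adj_sub := fun h => map_mem_edgeImage.1 (hB h)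
      edge_vert := fun h => hAB _ h _ (Sym2.mem_mk_left _ _)
      symm := ⟨fun u v h => by rw [Sym2.eq_swap]; exact h⟩ }
  have hv : φ '' H.verts = A := by
    ext w
    constructor
    · rintro ⟨v, hv, rfl⟩
      exact hv
    · intro hw
      obtain ⟨v, -, rfl⟩ := Finset.mem_map.1 (hA hw)
      exact ⟨v, hw, rfl⟩
  have he : Sym2.map φ '' H.edgeSet = B := by
    ext e
    constructor
    · rintro ⟨e', he', rfl⟩
      induction e' with
      | _ u v => exact he'
    · intro he
      obtain ⟨e', -, rfl⟩ := mem_edgeImage.1 (hB he)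
      refine ⟨e', ?_, rfl⟩
      induction e' with
      | _ u v => exact he
  have hvc : H.verts.ncard = #A := by
    rw [← Set.ncard_image_of_injective _ φ.injective, hv, Set.ncard_coe_finset]
  have hec : H.edgeSet.ncard = #B := by
    rw [← Set.ncard_image_of_injective _ (Sym2.map.injective φ.injective), he,
      Set.ncard_coe_finset]
  have hH : H ≠ ⊤ := by
    intro h
    refine hneq (Prod.ext ?_ ?_)
    · rw [← coe_inj, ← hv, h]
      simp
    · rw [← coe_inj, ← he, h]
      ext e
      simp [mem_edgeImage]
  have h := hF.2 H hH
  rw [subDensity, density, hvc, hec, div_lt_div_iff₀ (by exact_mod_cast hne.card_pos)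
    (by exact_mod_cast (strictlyBalanced_card hF).1)] at h
  rw [mul_comm]
  exact_mod_cast h

open scoped Classical in
/-- The copies of a strictly balanced graph in the graphs with vertices `W`. -/
noncomputable def model {F : SimpleGraph V} (hF : StrictlyBalanced F) (W : Type*) [Fintype W] [DecidableEq W] :
    CopyModel (SimpleGraph W) (V ↪ W) W (Sym2 W) where
  verts φ := univ.map φ
  edges φ := edgeImage F φ
  present G := {φ | ∀ e ∈ edgeImage F φ, e ∈ G.edgeSet}
  IsSub _ A B := EdgesWithin A B
  k := Nat.card V
  l := Nat.card F.edgeSet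
  a := Nat.card (F ≃g F)
  k_pos := (strictlyBalanced_card hF).1
  l_pos := (strictlyBalanced_card hF).2
  a_pos := Nat.card_pos
  card_verts φ := by rw [card_map, card_univ, Nat.card_eq_fintype_card]
  card_edges φ := card_edgeImage φ
  card_fiber G φ hφ := by
    rw [← card_embeddings_same_image φ]
    congr 1
    ext φ'
    simp only [mem_filter, mem_univ, true_and, Prod.mk.injEq] at hφ ⊢
    constructor
    · exact fun h => h.2
    · exact fun h => ⟨h.2 ▸ hφ, h⟩
  isSub_present _ φ _ := edgesWithin_edgeImage φ
  isSub_empty _ B := by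
    constructor
    · intro h
      rw [eq_empty_iff_forall_notMem]
      intro e he
      induction e with
      | _ x y => exact notMem_empty _ (h _ he x (Sym2.mem_mk_left x y))
    · rintro rfl e he
      exact absurd he (notMem_empty e)
  isSub_union _ A B A' B' h h' := by
    intro e he x hx
    rcases mem_union.1 he with he | he
    · exact mem_union_left _ (h e he x hx)
    · exact mem_union_right _ (h' e he x hx)
  isSub_inter _ A B A' B' h h' := by
    intro e he x hx
    rw [mem_inter] at he ⊢
    exact ⟨h e he.1 x hx, h' e he.2 x hx⟩
  balanced _ φ _ A B h hA hB hne hneq := mul_card_lt hF φ h hA hB hne hneq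

end Simple

/-! ### Simple graphs: the copy count, and graphs containing prescribed edges. -/

namespace Simple

variable {V : Type*} [Fintype V] {F : SimpleGraph V}

lemma count_model (hF : StrictlyBalanced F) {W : Type*} [Fintype W] [DecidableEq W]
    (G : SimpleGraph W) : (model hF W).count G = G.copyCount F := by
  classical
  have := Fintype.ofFinite {f : F →g G // Function.Injective f}
  rw [SimpleGraph.copyCount_eq_card_image_copyToSubgraph]
  have hinj : Function.Injective fun H : G.Subgraph =>
      (H.verts.toFinset, H.edgeSet.toFinset) := by
    intro H H' h
    rw [Prod.mk.injEq, Set.toFinset_inj, Set.toFinset_inj] at h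
    refine SimpleGraph.Subgraph.ext h.1 ?_
    ext u v
    rw [← SimpleGraph.Subgraph.mem_edgeSet, h.2, SimpleGraph.Subgraph.mem_edgeSet]
  rw [← card_image_of_injective _ hinj, image_image, CopyModel.count]
  have hpair : ∀ f : F.Copy G, (f.toSubgraph.verts.toFinset, f.toSubgraph.edgeSet.toFinset)
      = (univ.map f.toEmbedding, edgeImage F f.toEmbedding) := by
    intro f
    refine Prod.ext ?_ ?_
    · ext w
      simp
      rfl
    · ext e
      simp [mem_edgeImage]
      rfl
  congr 1
  ext x
  simp only [mem_image, model, mem_filter, mem_univ, true_and, Function.comp, hpair]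
  constructor
  · rintro ⟨φ, hφ, rfl⟩
    rw [edgeImage_subset_iff] at hφ
    exact ⟨⟨⟨φ, fun h => hφ _ _ h⟩, φ.injective⟩, rfl⟩
  · rintro ⟨f, rfl⟩
    exact ⟨f.toEmbedding, edgeImage_subset_iff.2 fun u v h => f.toHom.map_adj h, rfl⟩

open scoped Classical in
/-- The graphs with vertices `W` and `m` edges. -/
noncomputable def graphs (W : Type*) [Fintype W] (m : ℕ) : Finset (SimpleGraph W) :=
  {G | Nat.card G.edgeSet = m}

open scoped Classical in
lemma card_graphs_containing {W : Type*} [Fintype W] (m : ℕ) (B : Finset (Sym2 W)) :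
    #{G ∈ graphs W m | ∀ e ∈ B, e ∈ G.edgeSet}
      = #{s ∈ powersetCard m (⊤ : SimpleGraph W).edgeFinset | B ⊆ s} := by
  refine card_bij (fun G _ => G.edgeFinset) ?_ ?_ ?_
  · intro G hG
    simp only [graphs, mem_filter, mem_univ, true_and] at hG
    simp only [mem_filter, mem_powersetCard]
    refine ⟨⟨SimpleGraph.edgeFinset_mono le_top, ?_⟩, fun e he => ?_⟩
    · rw [← hG.1, Nat.card_eq_fintype_card, SimpleGraph.edgeFinset_card]
    · exact SimpleGraph.mem_edgeFinset.2 (hG.2 e he)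
  · intro G _ G' _ h
    exact SimpleGraph.edgeFinset_inj.1 h
  · intro s hs
    simp only [mem_filter, mem_powersetCard] at hs
    obtain ⟨G, hset⟩ : ∃ G : SimpleGraph W, G.edgeSet = s := by
      refine ⟨SimpleGraph.fromEdgeSet s, ?_⟩
      rw [SimpleGraph.edgeSet_fromEdgeSet, sdiff_eq_left, Set.disjoint_left]
      intro e he hd
      have := SimpleGraph.mem_edgeFinset.1 (hs.1.1 he)
      exact (SimpleGraph.not_isDiag_of_mem_edgeSet _ this) hd
    refine ⟨G, ?_, ?_⟩
    · simp only [graphs, mem_filter, mem_univ, true_and, hset]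
      exact ⟨by simpa using hs.1.2, fun e he => hs.2 he⟩
    · exact Finset.ext fun e => SimpleGraph.mem_edgeFinset.trans (by rw [hset, mem_coe])

open scoped Classical in
lemma card_graphs (W : Type*) [Fintype W] (m : ℕ) :
    #(graphs W m) = ((Fintype.card W).choose 2).choose m := by
  have := card_graphs_containing (W := W) m ∅
  rwa [filter_true_of_mem (by simp), filter_true_of_mem (by simp), card_powersetCard,
    SimpleGraph.card_edgeFinset_top_eq_card_choose_two] at this

open scoped Classical in
-- With N = C(|W|, 2) and b = #B this is C(N-b, m-b) (N)_b = C(N, m) (m)_b, stated as a product so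
-- that it also covers m < b, where both sides vanish.
lemma card_graphs_containing_mul {W : Type*} [Fintype W] (m : ℕ) (B : Finset (Sym2 W))
    (hB : ∀ e ∈ B, ¬ e.IsDiag) :
    #{G ∈ graphs W m | ∀ e ∈ B, e ∈ G.edgeSet} * ((Fintype.card W).choose 2).descFactorial #B
      = #(graphs W m) * m.descFactorial #B := by
  rw [card_graphs, card_graphs_containing m B]
  rcases lt_or_ge m #B with h | h
  · rw [Nat.descFactorial_eq_zero_iff_lt.2 h, mul_zero, mul_eq_zero]
    left
    rw [card_eq_zero, filter_eq_empty_iff]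
    intro s hs hBs
    have := card_le_card hBs
    rw [(mem_powersetCard.1 hs).2] at this
    omega
  · rw [card_filter_powersetCard_subset _ _ _ _ h,
      SimpleGraph.card_edgeFinset_top_eq_card_choose_two, Nat.descFactorial_eq_factorial_mul_choose,
      Nat.descFactorial_eq_factorial_mul_choose, mul_left_comm, mul_left_comm _ (#B).factorial,
      Nat.choose_mul h, mul_comm (((Fintype.card W).choose 2 - #B).choose _)]
    intro e he
    rw [SimpleGraph.mem_edgeFinset, SimpleGraph.edgeSet_top]
    exact hB e he

lemma not_isDiag_of_mem_edgeImage {W : Type*} {φ : V ↪ W} {e : Sym2 W}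
    (he : e ∈ edgeImage F φ) : ¬ e.IsDiag := by
  obtain ⟨e', he', rfl⟩ := mem_edgeImage.1 he
  rw [Sym2.isDiag_map φ.injective]
  exact F.not_isDiag_of_mem_edgeSet he'

open scoped Classical in
lemma card_graphs_containing_div {W : Type*} [Fintype W] {m : ℕ}
    (hm : m ≤ (Fintype.card W).choose 2) (B : Finset (Sym2 W)) (hB : ∀ e ∈ B, ¬ e.IsDiag) :
    (#{G ∈ graphs W m | ∀ e ∈ B, e ∈ G.edgeSet} : ℝ) / #(graphs W m)
      = (m.descFactorial #B : ℝ) / ((Fintype.card W).choose 2).descFactorial #B := by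
  have h := card_graphs_containing_mul m B hB
  have hle : #B ≤ (Fintype.card W).choose 2 := by
    rw [← SimpleGraph.card_edgeFinset_top_eq_card_choose_two]
    refine card_le_card fun e he => ?_
    rw [SimpleGraph.mem_edgeFinset, SimpleGraph.edgeSet_top]
    exact hB e he
  have h1 : (#(graphs W m) : ℝ) ≠ 0 := by
    rw [card_graphs]
    exact Nat.cast_ne_zero.2 (Nat.choose_pos hm).ne'
  have h2 : (((Fintype.card W).choose 2).descFactorial #B : ℝ) ≠ 0 :=
    Nat.cast_ne_zero.2 (Nat.descFactorial_eq_zero_iff_lt.not.2 hle.not_gt)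
  rw [div_eq_div_iff h1 h2, mul_comm (m.descFactorial _ : ℝ)]
  exact_mod_cast h

lemma hits_div (hF : StrictlyBalanced F) {W : Type*} [Fintype W] [DecidableEq W] {m r : ℕ}
    (hm : m ≤ (Fintype.card W).choose 2) (T : Fin r → (V ↪ W)) :
    ((model hF W).hits (graphs W m) T : ℝ) / #(graphs W m)
      = (m.descFactorial #((model hF W).allEdges T) : ℝ) /
        ((Fintype.card W).choose 2).descFactorial #((model hF W).allEdges T) := by
  classical
  rw [← card_graphs_containing_div hm, CopyModel.hits]
  · congr 3
    ext G
    simp only [model, CopyModel.allEdges, mem_filter, mem_univ, true_and, mem_biUnion]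
    exact and_congr_right fun _ => ⟨fun h e ⟨i, hi⟩ => h i e hi, fun h i e hi => h e ⟨i, hi⟩⟩
  · intro e he
    obtain ⟨i, -, hi⟩ := mem_biUnion.1 he
    exact not_isDiag_of_mem_edgeImage hi

end Simple

/-- Factor by factor, (m - i)/(N - i) ≤ m/N when m ≤ N. -/
lemma descFactorial_mul_pow_le {m N : ℕ} (h : m ≤ N) (e : ℕ) :
    m.descFactorial e * N ^ e ≤ m ^ e * N.descFactorial e := by
  induction e with
  | zero => simp
  | succ e ih =>
    rw [Nat.descFactorial_succ, Nat.descFactorial_succ, pow_succ, pow_succ]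
    have h1 : (m - e) * N ≤ m * (N - e) := by
      rw [Nat.sub_mul, Nat.mul_sub]
      have := Nat.mul_le_mul_left e h
      rw [mul_comm m e]
      omega
    calc (m - e) * m.descFactorial e * (N ^ e * N)
        = (m.descFactorial e * N ^ e) * ((m - e) * N) := by ring
      _ ≤ (m ^ e * N.descFactorial e) * (m * (N - e)) := Nat.mul_le_mul ih h1
      _ = m ^ e * m * ((N - e) * N.descFactorial e) := by ring

lemma descFactorial_div_le {m N : ℕ} (h : m ≤ N) (e : ℕ) :
    (m.descFactorial e : ℝ) / N.descFactorial e ≤ ((m : ℝ) / N) ^ e := by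
  rcases Nat.eq_zero_or_pos (N.descFactorial e) with h0 | h0
  · rw [h0, Nat.cast_zero, div_zero]
    positivity
  rcases Nat.eq_zero_or_pos N with rfl | hN
  · obtain rfl := Nat.le_zero.1 h
    rcases e with _ | e <;> simp
  rw [div_pow, div_le_div_iff₀ (by exact_mod_cast h0) (by positivity)]
  exact_mod_cast descFactorial_mul_pow_le h e

/-! ### Simple graphs: contributions of disjoint families and of families of given size. -/

namespace Simple

variable {V : Type*} [Fintype V] {F : SimpleGraph V}

lemma disj_iff (hF : StrictlyBalanced F) {W : Type*} [Fintype W] [DecidableEq W] {r : ℕ}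
    (T : Fin r → (V ↪ W)) : (model hF W).Disj T ↔
      ∀ i j, i ≠ j → Disjoint (univ.map (T i)) (univ.map (T j)) := by
  refine forall₃_congr fun i j _ => ⟨fun h => h.1, fun h => ⟨h, ?_⟩⟩
  have hsub : (model hF W).IsSub ⊥ (univ.map (T i) ∩ univ.map (T j))
      (edgeImage F (T i) ∩ edgeImage F (T j)) :=
    (model hF W).isSub_inter ⊥ _ _ _ _ (edgesWithin_edgeImage (T i)) (edgesWithin_edgeImage (T j))
  rw [disjoint_iff_inter_eq_empty.1 h, CopyModel.isSub_empty] at hsub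
  exact disjoint_iff_inter_eq_empty.2 hsub

lemma card_allEdges_of_disj (hF : StrictlyBalanced F) {W : Type*} [Fintype W] [DecidableEq W]
    {r : ℕ} {T : Fin r → (V ↪ W)} (hT : (model hF W).Disj T) :
    #((model hF W).allEdges T) = r * Nat.card F.edgeSet := by
  rw [CopyModel.allEdges, card_biUnion fun i _ j _ hij => (hT i j hij).2,
    sum_congr rfl fun i _ => (model hF W).card_edges (T i)]
  simp [model]

open scoped Classical in
lemma sum_good (hF : StrictlyBalanced F) {W : Type*} [Fintype W] [DecidableEq W] {m : ℕ}
    (hm : m ≤ (Fintype.card W).choose 2) (r : ℕ) :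
    ((∑ T : Fin r → (V ↪ W) with (model hF W).Disj T,
      (model hF W).hits (graphs W m) T : ℕ) : ℝ) / #(graphs W m)
      = (Fintype.card W).descFactorial (r * Nat.card V) *
        ((m.descFactorial (r * Nat.card F.edgeSet) : ℝ) /
          ((Fintype.card W).choose 2).descFactorial (r * Nat.card F.edgeSet)) := by
  rw [Nat.cast_sum, sum_div]
  simp only [hits_div hF hm]
  rw [sum_congr rfl fun T hT => by rw [card_allEdges_of_disj hF (mem_filter.1 hT).2], sum_const,
    nsmul_eq_mul, Nat.card_eq_fintype_card (α := V), ← card_disjoint_embeddings]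
  simp only [disj_iff]
  congr!

open scoped Classical in
lemma sum_bad_le (hF : StrictlyBalanced F) {W : Type*} [Fintype W] [DecidableEq W] {m : ℕ}
    (hm : m ≤ (Fintype.card W).choose 2) (r v e : ℕ) :
    ((∑ T : Fin r → (V ↪ W) with #((model hF W).allVerts T) = v ∧ #((model hF W).allEdges T) = e,
      (model hF W).hits (graphs W m) T : ℕ) : ℝ) / #(graphs W m)
      ≤ v ^ (r * Nat.card V) * ((Fintype.card W : ℝ) ^ v *
        ((m : ℝ) / (Fintype.card W).choose 2) ^ e) := by
  rw [Nat.cast_sum, sum_div]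
  simp only [hits_div hF hm]
  rw [sum_congr rfl fun T hT => by rw [(mem_filter.1 hT).2.2], sum_const, nsmul_eq_mul,
    Nat.card_eq_fintype_card, ← mul_assoc, mul_comm ((v : ℝ) ^ _)]
  refine mul_le_mul ?_ (descFactorial_div_le hm e) (by positivity) (by positivity)
  have h := card_embeddings_union_card_le V W r v
  refine le_trans (Nat.cast_le.2 (card_le_card fun T hT => ?_))
    ((Nat.cast_le.2 h).trans_eq (by push_cast; rfl))
  simp only [mem_filter, mem_univ, true_and] at hT ⊢
  rw [← hT.1, CopyModel.allVerts]
  congr!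

end Simple

/-- The source of the factor 2 in λ = (2c)^l / aut(F): edges lie among C(n,2) pairs rather than n^2.
-/
lemma tendsto_sq_div_choose_two :
    Tendsto (fun n : ℕ => (n : ℝ) ^ 2 / (n.choose 2 : ℝ)) atTop (𝓝 2) := by
  have h := (tendsto_descFactorial_div_pow 2).inv₀ one_ne_zero
  have h2 := h.const_mul 2
  rw [inv_one, mul_one] at h2
  refine h2.congr fun n => ?_
  rw [Nat.descFactorial_eq_factorial_mul_choose, inv_div]
  push_cast [Nat.factorial]
  ring

lemma tendsto_choose_two : Tendsto (fun n : ℕ => n.choose 2) atTop atTop := by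
  refine tendsto_atTop_mono' _ ?_ (tendsto_sub_atTop_nat 1)
  filter_upwards [eventually_ge_atTop 2] with n hn
  rw [Nat.choose_two_right, Nat.le_div_iff_mul_le two_pos, mul_comm]
  exact Nat.mul_le_mul_right _ hn

/-- The Poisson limit law for simple graphs. -/
theorem tendsto_simpleProb {V : Type*} [Finite V] {F : SimpleGraph V} (hF : StrictlyBalanced F)
    {c : ℝ} (hc : 0 < c) {m : ℕ → ℕ} (hm : Tendsto m atTop atTop)
    (h : Asymptotics.IsEquivalent atTop (fun n : ℕ => (m n : ℝ))
      (fun n : ℕ => c * (n : ℝ) ^ (2 - 1 / density F))) (t : ℕ) :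
    Tendsto (fun n : ℕ => simpleProb F n (m n) t) atTop
      (𝓝 (((2 * c) ^ Nat.card F.edgeSet / (Nat.card (F ≃g F) : ℝ)) ^ t / t.factorial *
        Real.exp (-((2 * c) ^ Nat.card F.edgeSet / (Nat.card (F ≃g F) : ℝ))))) := by
  classical
  have := Fintype.ofFinite V
  obtain ⟨hk, hl⟩ := Simple.strictlyBalanced_card hF
  set k := Nat.card V with hkdef
  set l := Nat.card F.edgeSet with hldef
  have hp : Tendsto (fun n : ℕ => (m n : ℝ) / (n.choose 2 : ℝ) * (n : ℝ) ^ ((k : ℝ) / l)) atTop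
      (𝓝 (2 * c)) := by
    rw [density, one_div_div] at h
    refine (tendsto_sq_div_choose_two.mul (tendsto_edge_density hc h)).congr' ?_
    filter_upwards [eventually_gt_atTop 0] with n hn
    have : (n : ℝ) ≠ 0 := by exact_mod_cast hn.ne'
    field_simp
    rw [← hkdef, ← hldef]
  -- The edge density tends to 0, so eventually graphs with `m n` edges exist and the quotient
  -- formulas apply.
  have hle : ∀ᶠ n : ℕ in atTop, m n ≤ n.choose 2 := by
    have hs : (0 : ℝ) < (k : ℝ) / l := by positivity
    have h0 : Tendsto (fun n : ℕ => (m n : ℝ) / (n.choose 2 : ℝ)) atTop (𝓝 0) := by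
      have h1 := hp.mul ((tendsto_rpow_neg_atTop hs).comp tendsto_natCast_atTop_atTop)
      rw [mul_zero] at h1
      refine h1.congr' ?_
      filter_upwards [eventually_gt_atTop 0] with n hn
      have hn' : (0 : ℝ) < n := by exact_mod_cast hn
      simp only [Function.comp]
      rw [mul_assoc, ← Real.rpow_add hn', add_neg_cancel, Real.rpow_zero, mul_one]
    filter_upwards [h0.eventually (gt_mem_nhds one_pos),
      tendsto_choose_two.eventually_gt_atTop 0] with n hn hpos
    rw [div_lt_one (by exact_mod_cast hpos)] at hn
    exact_mod_cast hn.le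
  have key := CopyModel.tendsto_poisson (fun n => Simple.model hF (Fin n))
    (fun n => Simple.graphs (Fin n) (m n)) (k := k) (l := l) (a := Nat.card (F ≃g F))
    (fun _ => rfl) (fun _ => rfl) (fun _ => rfl) (fun n => (m n : ℝ) / (n.choose 2 : ℝ)) (2 * c) hp
    (fun r => by
      have h1 := ((((tendsto_descFactorial_div_pow (r * k)).mul
        ((tendsto_descFactorial_div_pow (r * l)).comp hm)).div
        ((tendsto_descFactorial_div_pow (r * l)).comp tendsto_choose_two) one_ne_zero).mul
        (tendsto_pow_mul_pow hl hp r))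
      rw [one_mul, div_one, one_mul] at h1
      refine h1.congr' ?_
      filter_upwards [hle, eventually_gt_atTop 0, hm.eventually_gt_atTop 0,
        tendsto_choose_two.eventually_gt_atTop 0] with n hn hn0 hm0 hN0
      rw [Simple.sum_good hF (by rwa [Fintype.card_fin]), Fintype.card_fin]
      simp only [Function.comp, Pi.div_apply]
      rw [← hkdef, ← hldef]
      have e1 : (n : ℝ) ^ (r * k) ≠ 0 := by positivity
      have e2 : (m n : ℝ) ^ (r * l) ≠ 0 := by positivity
      have e3 : (n.choose 2 : ℝ) ^ (r * l) ≠ 0 := by positivity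
      rw [div_pow]
      generalize (n : ℝ) ^ (r * k) = x1 at *
      generalize (m n : ℝ) ^ (r * l) = x2 at *
      generalize (n.choose 2 : ℝ) ^ (r * l) = x3 at *
      field_simp)
    (fun r v e => by
      refine ⟨(v : ℝ) ^ (r * k), ?_⟩
      filter_upwards [hle] with n hn
      have := Simple.sum_bad_le hF (W := Fin n) (m := m n) (by rwa [Fintype.card_fin]) r v e
      rwa [Fintype.card_fin] at this) t
  refine key.congr fun n => ?_
  have e1 : (simpleGraphs n (m n)).ncard = #(Simple.graphs (Fin n) (m n)) := by
    rw [← Set.ncard_coe_finset]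
    congr 1
    ext G
    simp [simpleGraphs, Simple.graphs]
  have e2 : (simpleGraphsWithCopies F n (m n) t).ncard =
      #{ω ∈ Simple.graphs (Fin n) (m n) | (Simple.model hF (Fin n)).count ω = t} := by
    rw [← Set.ncard_coe_finset]
    congr 1
    ext G
    simp [simpleGraphsWithCopies, simpleGraphs, Simple.graphs, Simple.count_model]
  rw [simpleProb, e1, e2]

/-! ### Copies in multigraphs -/

namespace Multigraph

variable {V E : Type*} [Fintype V] [Fintype E]

/-- The endpoints of the edges determine a multigraph. -/
def equivFun (W D : Type*) : Multigraph W D ≃ (D → W × W) where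
  toFun G d := (G.src d, G.tgt d)
  invFun f := ⟨fun d => (f d).1, fun d => (f d).2⟩
  left_inv _ := rfl
  right_inv _ := rfl

noncomputable instance {W D : Type*} [Fintype W] [Fintype D] : Fintype (Multigraph W D) :=
  have : Finite (Multigraph W D) := Finite.of_equiv _ (equivFun W D).symm
  Fintype.ofFinite _

lemma Iso.ext' {V E V' E' : Type*} {M : Multigraph V E} {N : Multigraph V' E'} {σ τ : M.Iso N}
    (h : ∀ v, σ.onVerts v = τ.onVerts v) (h' : ∀ e, σ.onEdges e = τ.onEdges e) : σ = τ := by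
  cases σ
  cases τ
  congr
  · exact Equiv.ext h
  · exact Equiv.ext h'

instance (F : Multigraph V E) : Finite (F.Iso F) :=
  Finite.of_injective (fun σ => (σ.onVerts, σ.onEdges)) fun σ τ h => by
    rw [Prod.mk.injEq] at h
    exact Iso.ext' (fun v => DFunLike.congr_fun h.1 v) fun e => DFunLike.congr_fun h.2 e

instance (F : Multigraph V E) : Nonempty (F.Iso F) :=
  ⟨⟨Equiv.refl V, Equiv.refl E, fun _ => rfl, fun _ => rfl⟩⟩

/-- The embeddings of vertices and edges send `F` to a subgraph of `G`. -/
def IsCopy {W D : Type*} (F : Multigraph V E) (G : Multigraph W D) (x : (V ↪ W) × (E ↪ D)) : Prop :=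
  ∀ e, G.src (x.2 e) = x.1 (F.src e) ∧ G.tgt (x.2 e) = x.1 (F.tgt e)

variable {F : Multigraph V E}

lemma exists_perm_of_map_eq {I W : Type*} [Fintype I] {φ φ' : I ↪ W}
    (h : univ.map φ' = univ.map φ) : ∃ σ : I ≃ I, ∀ i, φ (σ i) = φ' i := by
  have hex : ∀ i, ∃ j, φ j = φ' i := by
    intro i
    have := mem_map_of_mem φ' (mem_univ i)
    rw [h] at this
    simpa using this
  choose σ hσ using hex
  have hinj : Function.Injective σ := fun i j hij => φ'.injective (by rw [← hσ i, ← hσ j, hij])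
  exact ⟨Equiv.ofBijective σ (Finite.injective_iff_bijective.1 hinj), hσ⟩

open scoped Classical in
-- Two copies with the same vertices and edges differ by one permutation of each; injectivity of the
-- vertex embedding makes this pair an automorphism.
lemma card_copies_same_image {W D : Type*} [Fintype W] [Fintype D] {G : Multigraph W D}
    {x : (V ↪ W) × (E ↪ D)} (hx : F.IsCopy G x) :
    #{y : (V ↪ W) × (E ↪ D) | F.IsCopy G y ∧ univ.map y.1 = univ.map x.1 ∧
      univ.map y.2 = univ.map x.2} = Nat.card (F.Iso F) := by
  have := Fintype.ofFinite (F.Iso F)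
  rw [Nat.card_eq_fintype_card, ← card_univ]
  symm
  refine card_bij (fun σ _ => (σ.onVerts.toEmbedding.trans x.1, σ.onEdges.toEmbedding.trans x.2))
    ?_ ?_ ?_
  · intro σ _
    simp only [mem_filter, mem_univ, true_and]
    refine ⟨fun e => ?_, ?_, ?_⟩
    · have := hx (σ.onEdges e)
      rwa [σ.src_map, σ.tgt_map] at this
    · rw [← Finset.map_map, map_univ_equiv]
    · rw [← Finset.map_map, map_univ_equiv]
  · intro σ _ τ _ h
    rw [Prod.mk.injEq] at h
    exact Iso.ext' (fun v => x.1.injective (DFunLike.congr_fun h.1 v))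
      (fun e => x.2.injective (DFunLike.congr_fun h.2 e))
  · rintro ⟨φ, ψ⟩ hy
    simp only [mem_filter, mem_univ, true_and] at hy
    obtain ⟨hy, h1, h2⟩ := hy
    obtain ⟨σ, hσ⟩ := exists_perm_of_map_eq h1
    obtain ⟨τ, hτ⟩ := exists_perm_of_map_eq h2
    refine ⟨⟨σ, τ, fun e => x.1.injective ?_, fun e => x.1.injective ?_⟩, mem_univ _, ?_⟩
    · rw [← (hx _).1, hτ, (hy e).1, hσ]
    · rw [← (hx _).2, hτ, (hy e).2, hσ]
    · exact Prod.ext (DFunLike.ext _ _ hσ) (DFunLike.ext _ _ hτ)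

lemma strictlyBalanced_card (hF : F.StrictlyBalanced) : 0 < Nat.card V ∧ 0 < Nat.card E := by
  obtain ⟨hV, hF⟩ := hF
  refine ⟨Nat.card_pos, ?_⟩
  have h := hF ⟨∅, ∅, by simp, by simp⟩ fun h => Set.empty_ne_univ h.1
  by_contra h0
  have h1 : Fintype.card E = 0 := by
    rw [← Nat.card_eq_fintype_card]
    omega
  simp [density, h1] at h

/-- `A` and `B` are the vertices and the edges of a subgraph. -/
def EdgesWithin {W D : Type*} (G : Multigraph W D) (A : Finset W) (B : Finset D) : Prop :=
  ∀ e ∈ B, G.src e ∈ A ∧ G.tgt e ∈ A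

lemma mul_card_lt {W D : Type*} (hF : F.StrictlyBalanced) {G : Multigraph W D}
    {x : (V ↪ W) × (E ↪ D)} (hx : F.IsCopy G x) {A : Finset W} {B : Finset D}
    (hAB : G.EdgesWithin A B) (hA : A ⊆ univ.map x.1) (hB : B ⊆ univ.map x.2) (hne : A.Nonempty)
    (hneq : (A, B) ≠ (univ.map x.1, univ.map x.2)) :
    Nat.card V * #B < Nat.card E * #A := by
  classical
  let H : F.Subgraph :=
    { verts := {v | x.1 v ∈ A}
      edges := {e | x.2 e ∈ B}
      src_mem := fun e he => by
        have := (hAB _ he).1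
        rwa [(hx e).1] at this
      tgt_mem := fun e he => by
        have := (hAB _ he).2
        rwa [(hx e).2] at this }
  have hv : x.1 '' H.verts = A := by
    ext w
    constructor
    · rintro ⟨v, hv, rfl⟩
      exact hv
    · intro hw
      obtain ⟨v, -, rfl⟩ := Finset.mem_map.1 (hA hw)
      exact ⟨v, hw, rfl⟩
  have he : x.2 '' H.edges = B := by
    ext w
    constructor
    · rintro ⟨v, hv, rfl⟩
      exact hv
    · intro hw
      obtain ⟨v, -, rfl⟩ := Finset.mem_map.1 (hB hw)
      exact ⟨v, hw, rfl⟩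
  have hvc : Nat.card H.verts = #A := by
    rw [Nat.card_coe_set_eq, ← Set.ncard_image_of_injective _ x.1.injective, hv,
      Set.ncard_coe_finset]
  have hec : Nat.card H.edges = #B := by
    rw [Nat.card_coe_set_eq, ← Set.ncard_image_of_injective _ x.2.injective, he,
      Set.ncard_coe_finset]
  have h := hF.2 H (by
    rintro ⟨h1, h2⟩
    refine hneq (Prod.ext ?_ ?_)
    · rw [← coe_inj, ← hv, h1]
      simp
    · rw [← coe_inj, ← he, h2]
      simp)
  rw [density, density, hvc, hec, div_lt_div_iff₀ (by exact_mod_cast hne.card_pos)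
    (by exact_mod_cast (strictlyBalanced_card hF).1)] at h
  rw [mul_comm]
  exact_mod_cast h

open scoped Classical in
/-- The copies of a strictly balanced multigraph in the multigraphs with vertices `W` and
edges `D`. -/
noncomputable def model (hF : F.StrictlyBalanced) (W D : Type*) [Fintype W] [Fintype D]
    [DecidableEq W] [DecidableEq D] :
    CopyModel (Multigraph W D) ((V ↪ W) × (E ↪ D)) W D where
  verts x := univ.map x.1
  edges x := univ.map x.2
  present G := {x | F.IsCopy G x}
  IsSub G A B := G.EdgesWithin A B
  k := Nat.card V
  l := Nat.card E
  a := Nat.card (F.Iso F)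
  k_pos := (strictlyBalanced_card hF).1
  l_pos := (strictlyBalanced_card hF).2
  a_pos := Nat.card_pos
  card_verts x := by rw [card_map, card_univ, Nat.card_eq_fintype_card]
  card_edges x := by rw [card_map, card_univ, Nat.card_eq_fintype_card]
  card_fiber G x hx := by
    rw [← card_copies_same_image (mem_filter.1 hx).2, filter_filter]
    simp only [Prod.mk.injEq]
    congr!
  isSub_present G x hx e he := by
    obtain ⟨e', -, rfl⟩ := Finset.mem_map.1 he
    have := (mem_filter.1 hx).2 e'
    rw [this.1, this.2]
    exact ⟨mem_map_of_mem _ (mem_univ _), mem_map_of_mem _ (mem_univ _)⟩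
  isSub_empty G B := by
    constructor
    · intro h
      rw [eq_empty_iff_forall_notMem]
      exact fun e he => notMem_empty _ (h e he).1
    · rintro rfl e he
      exact absurd he (notMem_empty e)
  isSub_union G A B A' B' h h' e he := by
    rcases mem_union.1 he with he | he
    · exact ⟨mem_union_left _ (h e he).1, mem_union_left _ (h e he).2⟩
    · exact ⟨mem_union_right _ (h' e he).1, mem_union_right _ (h' e he).2⟩
  isSub_inter G A B A' B' h h' e he := by
    rw [mem_inter] at he
    exact ⟨mem_inter.2 ⟨(h e he.1).1, (h' e he.2).1⟩, mem_inter.2 ⟨(h e he.1).2, (h' e he.2).2⟩⟩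
  balanced G x hx A B h hA hB hne hneq := mul_card_lt hF (mem_filter.1 hx).2 h hA hB hne hneq

lemma count_model (hF : F.StrictlyBalanced) {W D : Type*} [Fintype W] [Fintype D]
    [DecidableEq W] [DecidableEq D] (G : Multigraph W D) :
    (model hF W D).count G = G.copyCount F := by
  classical
  have hinj : Function.Injective fun H : G.Subgraph => (H.verts.toFinset, H.edges.toFinset) := by
    intro H H' h
    rw [Prod.mk.injEq, Set.toFinset_inj, Set.toFinset_inj] at h
    exact Subgraph.ext h.1 h.2
  rw [copyCount, ← Set.ncard_image_of_injective _ hinj, CopyModel.count, ← Set.ncard_coe_finset]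
  congr 1
  ext y
  simp only [coe_image, model, Set.mem_image, mem_coe, mem_filter, mem_univ, true_and,
    Set.mem_ofPred_eq]
  constructor
  · rintro ⟨x, hx, rfl⟩
    refine ⟨⟨Set.range x.1, Set.range x.2, ?_, ?_⟩, ⟨⟨Equiv.ofInjective _ x.1.injective,
      Equiv.ofInjective _ x.2.injective, fun e => Subtype.ext (hx e).1,
      fun e => Subtype.ext (hx e).2⟩⟩, ?_⟩
    · rintro _ ⟨e, rfl⟩
      exact ⟨_, (hx e).1.symm⟩
    · rintro _ ⟨e, rfl⟩
      exact ⟨_, (hx e).2.symm⟩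
    · refine Prod.ext ?_ ?_ <;> ext <;> simp
  · rintro ⟨H, ⟨σ⟩, rfl⟩
    refine ⟨(σ.onVerts.toEmbedding.trans (Function.Embedding.subtype _),
      σ.onEdges.toEmbedding.trans (Function.Embedding.subtype _)), fun e => ?_, ?_⟩
    · exact ⟨congrArg Subtype.val (σ.src_map e), congrArg Subtype.val (σ.tgt_map e)⟩
    · rw [← Finset.map_map, ← Finset.map_map, map_univ_equiv, map_univ_equiv]
      refine Prod.ext ?_ ?_ <;> ext <;> simp

/-! ### Multigraphs containing prescribed copies. -/

lemma card_multigraph (W D : Type*) [Fintype W] [Fintype D] :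
    Fintype.card (Multigraph W D) = (Fintype.card W ^ 2) ^ Fintype.card D := by
  classical
  rw [Fintype.card_congr (equivFun W D), Fintype.card_fun, Fintype.card_prod, sq]

lemma card_agree_mul {W D : Type*} [Fintype W] [Fintype D] [DecidableEq W] [DecidableEq D]
    (G : Multigraph W D) (B : Finset D) :
    #{G' : Multigraph W D | ∀ d ∈ B, G'.src d = G.src d ∧ G'.tgt d = G.tgt d}
      * (Fintype.card W ^ 2) ^ #B = (Fintype.card W ^ 2) ^ Fintype.card D := by
  have h : #{G' : Multigraph W D | ∀ d ∈ B, G'.src d = G.src d ∧ G'.tgt d = G.tgt d}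
      = #(Fintype.piFinset fun d => if d ∈ B then {equivFun W D G d} else univ) := by
    refine card_equiv (equivFun W D) fun G' => ?_
    simp only [mem_filter, mem_univ, true_and, Fintype.mem_piFinset]
    refine forall_congr' fun d => ?_
    by_cases hd : d ∈ B
    · simp [hd, equivFun]
    · simp [hd]
  have hB : (Fintype.card W ^ 2) ^ #B = ∏ d, if d ∈ B then Fintype.card W ^ 2 else 1 := by
    rw [prod_ite_mem, univ_inter, prod_const]
  have hD : (Fintype.card W ^ 2) ^ Fintype.card D = ∏ _d : D, Fintype.card W ^ 2 := by
    rw [prod_const, card_univ]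
  rw [h, Fintype.card_piFinset, hB, hD, ← prod_mul_distrib]
  refine prod_congr rfl fun d _ => ?_
  by_cases hd : d ∈ B
  · simp [hd]
  · simp [hd, sq]

/-- Once one multigraph contains all the copies, the others that do are those agreeing with it on
the edges used. The endpoints of distinct labels are independent and uniform on `W × W`. -/
lemma hits_div_of_present (hF : F.StrictlyBalanced) {W D : Type*} [Fintype W] [Fintype D]
    [DecidableEq W] [DecidableEq D] [Nonempty W] {r : ℕ} {T : Fin r → (V ↪ W) × (E ↪ D)}
    {G : Multigraph W D} (hG : ∀ i, F.IsCopy G (T i)) :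
    ((model hF W D).hits univ T : ℝ) / Fintype.card (Multigraph W D)
      = (1 / (Fintype.card W : ℝ) ^ 2) ^ #((model hF W D).allEdges T) := by
  classical
  have hhits : (model hF W D).hits univ T = #{G' : Multigraph W D |
      ∀ d ∈ (model hF W D).allEdges T, G'.src d = G.src d ∧ G'.tgt d = G.tgt d} := by
    rw [CopyModel.hits]
    congr 1
    ext G'
    simp only [model, CopyModel.allEdges, mem_filter, mem_univ, true_and, mem_biUnion]
    constructor
    · rintro h d ⟨i, hi⟩
      obtain ⟨e, -, rfl⟩ := Finset.mem_map.1 hi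
      rw [(h i e).1, (h i e).2, (hG i e).1, (hG i e).2]
      exact ⟨rfl, rfl⟩
    · intro h i e
      have := h _ ⟨i, mem_map_of_mem (T i).2 (mem_univ e)⟩
      rwa [(hG i e).1, (hG i e).2] at this
  have h := card_agree_mul G ((model hF W D).allEdges T)
  rw [← hhits, ← card_multigraph] at h
  have hW : (0 : ℝ) < Fintype.card W := by exact_mod_cast Fintype.card_pos
  have hM : (0 : ℝ) < Fintype.card (Multigraph W D) := by
    rw [card_multigraph]
    push_cast
    positivity
  rw [one_div, inv_pow, div_eq_iff hM.ne', ← div_eq_inv_mul, eq_div_iff (by positivity)]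
  exact_mod_cast h

/-- Only an inequality: overlapping copies may demand different endpoints for the same label, and
then no multigraph contains them. -/
lemma hits_div_le (hF : F.StrictlyBalanced) {W D : Type*} [Fintype W] [Fintype D]
    [DecidableEq W] [DecidableEq D] [Nonempty W] {r : ℕ} (T : Fin r → (V ↪ W) × (E ↪ D)) :
    ((model hF W D).hits univ T : ℝ) / Fintype.card (Multigraph W D)
      ≤ (1 / (Fintype.card W : ℝ) ^ 2) ^ #((model hF W D).allEdges T) := by
  classical
  by_cases h : ∃ G : Multigraph W D, ∀ i, F.IsCopy G (T i)
  · obtain ⟨G, hG⟩ := h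
    exact (hits_div_of_present hF hG).le
  · rw [CopyModel.hits_eq_zero fun G _ hG => h ⟨G, fun i => (mem_filter.1 (hG i)).2⟩, Nat.cast_zero, zero_div]
    positivity

/-- Disjoint copies use distinct labels, so their demands never conflict; every other edge becomes a
loop at a fixed vertex. -/
lemma exists_of_disj (hF : F.StrictlyBalanced) {W D : Type*} [Fintype W] [Fintype D]
    [DecidableEq W] [DecidableEq D] [Nonempty W] {r : ℕ} {T : Fin r → (V ↪ W) × (E ↪ D)}
    (hT : (model hF W D).Disj T) : ∃ G : Multigraph W D, ∀ i, F.IsCopy G (T i) := by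
  have hinj : Function.Injective fun x : Fin r × E => (T x.1).2 x.2 := by
    rintro ⟨i, x⟩ ⟨j, y⟩ h
    change (T i).2 x = (T j).2 y at h
    obtain rfl | hij := eq_or_ne i j
    · rw [(T i).2.injective h]
    · exact absurd (mem_map_of_mem (T j).2 (mem_univ y))
        (disjoint_left.1 (hT i j hij).2 (h ▸ mem_map_of_mem (T i).2 (mem_univ x)))
  obtain ⟨w⟩ := ‹Nonempty W›
  refine ⟨⟨Function.extend (fun x : Fin r × E => (T x.1).2 x.2)
      (fun x => (T x.1).1 (F.src x.2)) fun _ => w,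
    Function.extend (fun x : Fin r × E => (T x.1).2 x.2)
      (fun x => (T x.1).1 (F.tgt x.2)) fun _ => w⟩, fun i e => ⟨?_, ?_⟩⟩
  · have := hinj.extend_apply (fun x : Fin r × E => (T x.1).1 (F.src x.2)) (fun _ => w) (i, e)
    exact this
  · have := hinj.extend_apply (fun x : Fin r × E => (T x.1).1 (F.tgt x.2)) (fun _ => w) (i, e)
    exact this

open scoped Classical in
lemma card_pairs {I A B : Type*} [Fintype I] [Fintype A] [Fintype B] (P : (I → A) → Prop)
    (Q : (I → B) → Prop) :
    #{T : I → A × B | P (fun i => (T i).1) ∧ Q (fun i => (T i).2)}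
      = #{f : I → A | P f} * #{g : I → B | Q g} := by
  rw [← card_product]
  refine card_equiv (Equiv.arrowProdEquivProdArrow I (fun _ => A) (fun _ => B)) fun T => ?_
  simp only [mem_filter, mem_univ, true_and, mem_product]
  rfl

open scoped Classical in
lemma sum_good (hF : F.StrictlyBalanced) {W D : Type*} [Fintype W] [Fintype D]
    [DecidableEq W] [DecidableEq D] [Nonempty W] (r : ℕ) :
    ((∑ T : Fin r → (V ↪ W) × (E ↪ D) with (model hF W D).Disj T,
      (model hF W D).hits univ T : ℕ) : ℝ) / Fintype.card (Multigraph W D)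
      = (Fintype.card W).descFactorial (r * Nat.card V) *
        (Fintype.card D).descFactorial (r * Nat.card E) *
        (1 / (Fintype.card W : ℝ) ^ 2) ^ (r * Nat.card E) := by
  rw [Nat.cast_sum, sum_div]
  have h : ∀ T ∈ ({T | (model hF W D).Disj T} : Finset (Fin r → (V ↪ W) × (E ↪ D))),
      ((model hF W D).hits univ T : ℝ) / Fintype.card (Multigraph W D)
        = (1 / (Fintype.card W : ℝ) ^ 2) ^ (r * Nat.card E) := by
    intro T hT
    replace hT := (mem_filter.1 hT).2
    obtain ⟨G, hG⟩ := exists_of_disj hF hT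
    rw [hits_div_of_present hF hG, CopyModel.allEdges,
      card_biUnion fun i _ j _ hij => (hT i j hij).2,
      sum_congr rfl fun i _ => (model hF W D).card_edges (T i)]
    simp [model]
  have hcard : #{T : Fin r → (V ↪ W) × (E ↪ D) | (model hF W D).Disj T}
      = (Fintype.card W).descFactorial (r * Nat.card V) *
        (Fintype.card D).descFactorial (r * Nat.card E) := by
    rw [Nat.card_eq_fintype_card, Nat.card_eq_fintype_card, ← card_disjoint_embeddings,
      ← card_disjoint_embeddings]
    refine Eq.trans ?_ ((card_pairs
      (fun f : Fin r → (V ↪ W) => ∀ i j, i ≠ j → Disjoint (univ.map (f i)) (univ.map (f j)))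
      (fun g : Fin r → (E ↪ D) => ∀ i j, i ≠ j → Disjoint (univ.map (g i)) (univ.map (g j)))).trans
      (by congr!))
    congr 1
    ext T
    simp only [mem_filter, mem_univ, true_and]
    exact ⟨fun h => ⟨fun i j hij => (h i j hij).1, fun i j hij => (h i j hij).2⟩,
      fun h i j hij => ⟨h.1 i j hij, h.2 i j hij⟩⟩
  rw [sum_congr rfl h, sum_const, nsmul_eq_mul, hcard, Nat.cast_mul]

open scoped Classical in
-- At most n^v v^(rk) choices of vertices and m^e e^(rl) of edge labels, each tuple having
-- probability at most n^(-2e).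
lemma sum_bad_le (hF : F.StrictlyBalanced) {W D : Type*} [Fintype W] [Fintype D]
    [DecidableEq W] [DecidableEq D] [Nonempty W] (r v e : ℕ) :
    ((∑ T : Fin r → (V ↪ W) × (E ↪ D) with #((model hF W D).allVerts T) = v ∧
        #((model hF W D).allEdges T) = e, (model hF W D).hits univ T : ℕ) : ℝ) /
        Fintype.card (Multigraph W D)
      ≤ v ^ (r * Nat.card V) * e ^ (r * Nat.card E) * ((Fintype.card W : ℝ) ^ v *
        ((Fintype.card D : ℝ) / (Fintype.card W : ℝ) ^ 2) ^ e) := by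
  rw [Nat.cast_sum, sum_div]
  refine (sum_le_sum fun T _ => hits_div_le hF T).trans ?_
  rw [sum_congr rfl fun T hT => by rw [(mem_filter.1 hT).2.2], sum_const, nsmul_eq_mul,
    Nat.card_eq_fintype_card, Nat.card_eq_fintype_card, div_eq_mul_one_div (Fintype.card D : ℝ),
    mul_pow, ← mul_assoc, ← mul_assoc]
  refine mul_le_mul_of_nonneg_right ?_ (by positivity)
  have h0 := Nat.mul_le_mul (card_embeddings_union_card_le V W r v)
    (card_embeddings_union_card_le E D r e)
  have h := ((card_pairs
    (fun f : Fin r → (V ↪ W) => #(univ.biUnion fun i => univ.map (f i)) = v)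
    (fun g : Fin r → (E ↪ D) => #(univ.biUnion fun i => univ.map (g i)) = e)).trans
    (by congr!)).trans_le h0
  refine le_trans (Nat.cast_le.2 (card_le_card fun T hT => ?_))
    ((Nat.cast_le.2 h).trans_eq (by push_cast; ring))
  simp only [mem_filter, mem_univ, true_and] at hT ⊢
  rw [← hT.1, ← hT.2, CopyModel.allVerts, CopyModel.allEdges]
  constructor <;> congr!

/-- The Poisson limit law for multigraphs. -/
theorem tendsto_prob {V E : Type*} [Finite V] [Finite E] {F : Multigraph V E}
    (hF : F.StrictlyBalanced) {c : ℝ} (hc : 0 < c) {m : ℕ → ℕ} (hm : Tendsto m atTop atTop)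
    (h : Asymptotics.IsEquivalent atTop (fun n : ℕ => (m n : ℝ))
      (fun n : ℕ => c * (n : ℝ) ^ (2 - 1 / F.density))) (t : ℕ) :
    Tendsto (fun n : ℕ => F.prob n (m n) t) atTop
      (𝓝 ((c ^ Nat.card E / (Nat.card (F.Iso F) : ℝ)) ^ t / t.factorial *
        Real.exp (-(c ^ Nat.card E / (Nat.card (F.Iso F) : ℝ))))) := by
  classical
  have := Fintype.ofFinite V
  have := Fintype.ofFinite E
  obtain ⟨hk, hl⟩ := strictlyBalanced_card hF
  set k := Nat.card V with hkdef
  set l := Nat.card E with hldef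
  have hp : Tendsto (fun n : ℕ => (m n : ℝ) / (n : ℝ) ^ 2 * (n : ℝ) ^ ((k : ℝ) / l)) atTop
      (𝓝 c) := by
    rw [density, one_div_div] at h
    exact tendsto_edge_density hc h
  have key := CopyModel.tendsto_poisson (fun n => model hF (Fin n) (Fin (m n)))
    (fun n => univ) (k := k) (l := l) (a := Nat.card (F.Iso F))
    (fun _ => rfl) (fun _ => rfl) (fun _ => rfl) (fun n => (m n : ℝ) / (n : ℝ) ^ 2) c hp
    (fun r => by
      have h1 := (((tendsto_descFactorial_div_pow (r * k)).mul
        ((tendsto_descFactorial_div_pow (r * l)).comp hm)).mul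
        (tendsto_pow_mul_pow hl hp r))
      rw [one_mul, one_mul] at h1
      refine h1.congr' ?_
      filter_upwards [eventually_gt_atTop 0, hm.eventually_gt_atTop 0] with n hn0 hm0
      have : Nonempty (Fin n) := ⟨⟨0, hn0⟩⟩
      rw [card_univ, sum_good hF, Fintype.card_fin, Fintype.card_fin]
      simp only [Function.comp]
      rw [← hkdef, ← hldef]
      have e1 : (n : ℝ) ^ (r * k) ≠ 0 := by positivity
      have e2 : (m n : ℝ) ^ (r * l) ≠ 0 := by positivity
      rw [div_eq_mul_one_div (m n : ℝ), mul_pow]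
      generalize (n : ℝ) ^ (r * k) = x1 at *
      generalize (m n : ℝ) ^ (r * l) = x2 at *
      generalize (1 / (n : ℝ) ^ 2) ^ (r * l) = x3 at *
      field_simp)
    (fun r v e => by
      refine ⟨(v : ℝ) ^ (r * k) * (e : ℝ) ^ (r * l), ?_⟩
      filter_upwards [eventually_gt_atTop 0] with n hn0
      have : Nonempty (Fin n) := ⟨⟨0, hn0⟩⟩
      have := sum_bad_le hF (W := Fin n) (D := Fin (m n)) r v e
      rwa [Fintype.card_fin, Fintype.card_fin] at this) t
  refine key.congr fun n => ?_
  have e2 : (F.withCopies n (m n) t).ncard =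
      #{ω : Multigraph (Fin n) (Fin (m n)) | (model hF (Fin n) (Fin (m n))).count ω = t} := by
    rw [← Set.ncard_coe_finset]
    congr 1
    ext G
    simp [withCopies, count_model]
  rw [prob, e2, Nat.card_eq_fintype_card, card_univ]

end Multigraph

end SubgraphCount
theorem mainTheorem2 :
    -- simple graphs: Poisson limit law and number of `F`-free graphs
    (∀ (V : Type*) [Finite V] (F : SimpleGraph V), SubgraphCount.StrictlyBalanced F →
      ∀ (c : ℝ), 0 < c → ∀ (m : ℕ → ℕ), Filter.Tendsto m Filter.atTop Filter.atTop →
      Asymptotics.IsEquivalent Filter.atTop (fun n : ℕ => (m n : ℝ))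
        (fun n : ℕ => c * (n : ℝ) ^ (2 - 1 / SubgraphCount.density F)) →
      ∀ (lam : ℝ), lam = (2 * c) ^ Nat.card F.edgeSet / (Nat.card (F ≃g F) : ℝ) →
      (∀ t : ℕ, Filter.Tendsto (fun n : ℕ => SubgraphCount.simpleProb F n (m n) t) Filter.atTop
        (nhds (lam ^ t / (t.factorial : ℝ) * Real.exp (-lam)))) ∧
      Asymptotics.IsEquivalent Filter.atTop
        (fun n : ℕ => ((SubgraphCount.simpleGraphsWithCopies F n (m n) 0).ncard : ℝ))
        (fun n : ℕ => Real.exp (-lam) * ((SubgraphCount.simpleGraphs n (m n)).ncard : ℝ))) ∧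
    -- multigraphs: Poisson limit law and number of `F`-free multigraphs
    (∀ (V E : Type*) [Finite V] [Finite E] (F : SubgraphCount.Multigraph V E),
      F.StrictlyBalanced →
      ∀ (c : ℝ), 0 < c → ∀ (m : ℕ → ℕ), Filter.Tendsto m Filter.atTop Filter.atTop →
      Asymptotics.IsEquivalent Filter.atTop (fun n : ℕ => (m n : ℝ))
        (fun n : ℕ => c * (n : ℝ) ^ (2 - 1 / F.density)) →
      ∀ (lam : ℝ), lam = c ^ Nat.card E / (Nat.card (F.Iso F) : ℝ) →
      (∀ t : ℕ, Filter.Tendsto (fun n : ℕ => F.prob n (m n) t) Filter.atTop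
        (nhds (lam ^ t / (t.factorial : ℝ) * Real.exp (-lam)))) ∧
      Asymptotics.IsEquivalent Filter.atTop
        (fun n : ℕ => ((F.withCopies n (m n) 0).ncard : ℝ))
        (fun n : ℕ => Real.exp (-lam) *
          (Nat.card (SubgraphCount.Multigraph (Fin n) (Fin (m n))) : ℝ))) := by
  refine ⟨?_, ?_⟩
  · rintro V _ F hF c hc m hm h lam rfl
    have key := SubgraphCount.tendsto_simpleProb hF hc hm h
    refine ⟨key, SubgraphCount.isEquivalent_of_tendsto_div (Real.exp_ne_zero _) ?_⟩
    -- At t = 0 the Poisson weight is e^(-λ), which is nonzero, so the limit of the ratio is an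
    -- asymptotic equivalence.
    simpa [SubgraphCount.simpleProb] using key 0
  · rintro V E _ _ F hF c hc m hm h lam rfl
    have key := SubgraphCount.Multigraph.tendsto_prob hF hc hm h
    refine ⟨key, SubgraphCount.isEquivalent_of_tendsto_div (Real.exp_ne_zero _) ?_⟩
    simpa [SubgraphCount.Multigraph.prob] using key 0
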